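/- Let $d\ge 1$ be an integer, $s\in\mathbb R$, $\tau,h>0$, and let $C$ be a $d\times d$ real matrix valued function of $(t,\theta)$. Put $X=L^2([-\tau,0],\mathbb R^d)$, $X^+=L^2([0,h],\mathbb R^d)$, $X^\pm=L^2([-\tau,h],\mathbb R^d)$. For $(\phi,w)\in X\times X^+$ let $V(\phi,w)\in X^\pm$ be equal to $w$ on $(0,h]$ and to $\phi$ on $[-\tau,0]$, and let $V^-\phi=V(\phi,0)$, $V^+w=V(0,w)$. Let $\mathcal F\colon X^\pm\to X^+$, $\mathcal F v(t)=\int_{-\tau}^0 C(s+t,\theta)\,v(t+\theta)\,d\theta$. Let $H^{1,+}=H^1([0,h],\mathbb R^d)\subset X^+$, normed by $\|w\|_{H^{1,+}}^2=\|w\|_{X^+}^2+\|w'\|_{X^+}^2$ with $w'$ the weak derivative. Assume (H1) $C\in L^\infty([s,s+h]\times[-\tau,0],\mathbb R^{d\times d})$; (H2) $\mathcal F V^+$ maps $X^+$ into $H^{1,+}$ and is bounded as an operator $X^+\to H^{1,+}$. Let $\widetilde X^+$ be any linear subspace of $X^+$ that contains $H^{1,+}$ and whose elements can be evaluated pointwise: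 to each $w\in\widetilde X^+$ is assigned, linearly in $w$, one of its representatives, which on $[0,h]$ is the continuous one whenever $w$ has a continuous representative (for instance $\widetilde X^+=H^{1,+}$ or $\widetilde X^+=C([0,h],\mathbb R^d)$ with the usual evaluation). Let $\theta_1<\dots<\theta_N$ be the zeros of the Legendre polynomial of degree $N$ on $[0,h]$, with Lagrange polynomials $\ell_1,\dots,\ell_N$, and let $\mathcal L_N^+\colon\widetilde X^+\to X^+$, $\mathcal L_N^+w=\sum_{i=1}^N \ell_i\,w(\theta_i)$. Then $I-\mathcal F V^+\colon X^+\to X^+$ is invertible with bounded inverse, and there is a positive integer $N_0$ such that for every $N\ge N_0$: 1. the operator $I-\mathcal L_N^+\mathcal F V^+\colon X^+\to X^+$ is invertible and $$\|(I-\mathcal L_N^+\mathcal F V^+)^{-1}\|_{X^+\leftarrow X^+}\le 2\,\|(I-\mathcal F V^+)^{-1}\|_{X^+\leftarrow X^+};$$ 2. for each $\phi\in X$ the equation $w=\mathcal F V(\phi,w)$ has a unique solution $w^*\in X^+$, and if $\mathcal F V^-\phi\in\widetilde X^+$ (so that the next equation is meaningful), then the equation $w=\mathcal L_N^+\mathcal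 F V(\phi,w)$ has a unique solution $w_N^*\in X^+$, moreover $w^*\in\widetilde X^+$, and $$\|w_N^*-w^*\|_{X^+}\le 2\,\|(I-\mathcal F V^+)^{-1}\|_{X^+\leftarrow X^+}\,\|\mathcal L_N^+w^*-w^*\|_{X^+}.$$ -/

import Mathlib

noncomputable section

namespace RenewalCollocation

open MeasureTheory Set
open scoped ENNReal

/-- `ℝ^d` with the Euclidean norm. -/
abbrev Vec (d : ℕ) : Type := EuclideanSpace ℝ (Fin d)

/-- Lebesgue measure on the interval `[a, b]`. -/
abbrev leb (a b : ℝ) : Measure ℝ := volume.restrict (Icc a b)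

/-- The space `L²([a, b], ℝ^d)`. With `[a, b] = [-τ, 0]`, `[0, h]`, `[-τ, h]` this gives the
state space `X`, the space `X⁺` and the space `X^±`. -/
abbrev L2 (d : ℕ) (a b : ℝ) : Type := Lp (Vec d) 2 (leb a b)

/-! ### The operators `V`, `V⁻`, `V⁺` -/

section V

variable {d : ℕ} {τ h : ℝ}

/-- Pointwise formula of `V`: the value is `w t` on `(0, h]` and `φ t` on `[-τ, 0]`. -/
def glueFun (h : ℝ) (φ w : ℝ → Vec d) : ℝ → Vec d :=
  open Classical in fun t => if t ∈ Ioc 0 h then w t else φ t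

theorem glueFun_eq_piecewise (h : ℝ) (φ w : ℝ → Vec d) :
    glueFun h φ w = open Classical in (Ioc 0 h).piecewise w φ := by
  rfl

theorem restrict_Ioc_le (τ h : ℝ) :
    (leb (-τ) h).restrict (Ioc 0 h) ≤ leb 0 h := by
  rw [leb, Measure.restrict_restrict measurableSet_Ioc]
  exact Measure.restrict_mono (fun x hx => Ioc_subset_Icc_self hx.1) le_rfl

theorem restrict_compl_le (τ h : ℝ) :
    (leb (-τ) h).restrict (Ioc 0 h)ᶜ ≤ leb (-τ) 0 := by
  rw [leb, Measure.restrict_restrict measurableSet_Ioc.compl]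
  have hsub : (Ioc 0 h)ᶜ ∩ Icc (-τ) h ⊆ Icc (-τ) 0 := by
    intro x hx
    refine ⟨hx.2.1, ?_⟩
    by_contra hlt
    exact hx.1 ⟨not_le.mp hlt, hx.2.2⟩
  exact Measure.restrict_mono hsub le_rfl

theorem memLp_glueFun (φ : L2 d (-τ) 0) (w : L2 d 0 h) :
    MemLp (glueFun h φ w) 2 (leb (-τ) h) := by
  classical
  rw [glueFun_eq_piecewise]
  exact MemLp.piecewise measurableSet_Ioc
    ((Lp.memLp w).mono_measure (restrict_Ioc_le τ h))
    ((Lp.memLp φ).mono_measure (restrict_compl_le τ h))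

theorem glueFun_congr_ae {φ φ' w w' : ℝ → Vec d} (hφ : φ =ᵐ[leb (-τ) 0] φ')
    (hw : w =ᵐ[leb 0 h] w') : glueFun h φ w =ᵐ[leb (-τ) h] glueFun h φ' w' := by
  have h1 := ae_mono (restrict_Ioc_le τ h) hw
  have h2 := ae_mono (restrict_compl_le τ h) hφ
  have h1' := (ae_restrict_iff' measurableSet_Ioc).1 h1
  have h2' := (ae_restrict_iff' measurableSet_Ioc.compl).1 h2
  filter_upwards [h1', h2'] with t ht1 ht2
  unfold glueFun
  split_ifs with ht
  · exact ht1 ht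
  · exact ht2 ht

/-- The operator `V : X × X⁺ → X^±`. -/
def V (d : ℕ) (τ h : ℝ) : (L2 d (-τ) 0 × L2 d 0 h) →ₗ[ℝ] L2 d (-τ) h where
  toFun p := (memLp_glueFun p.1 p.2).toLp (glueFun h p.1 p.2)
  map_add' p q := by
    rw [← MemLp.toLp_add, MemLp.toLp_eq_toLp_iff]
    refine (glueFun_congr_ae (Lp.coeFn_add p.1 q.1) (Lp.coeFn_add p.2 q.2)).trans ?_
    refine Filter.Eventually.of_forall fun t => ?_
    simp only [glueFun, Pi.add_apply]
    split_ifs <;> rfl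
  map_smul' c p := by
    rw [RingHom.id_apply, ← MemLp.toLp_const_smul, MemLp.toLp_eq_toLp_iff]
    refine (glueFun_congr_ae (Lp.coeFn_smul c p.1) (Lp.coeFn_smul c p.2)).trans ?_
    refine Filter.Eventually.of_forall fun t => ?_
    simp only [glueFun, Pi.smul_apply]
    split_ifs <;> rfl

/-- `V⁻ φ = V(φ, 0)`. -/
def Vminus (d : ℕ) (τ h : ℝ) : L2 d (-τ) 0 →ₗ[ℝ] L2 d (-τ) h :=
  V d τ h ∘ₗ LinearMap.inl ℝ _ _

/-- `V⁺ w = V(0, w)`. -/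
def Vplus (d : ℕ) (τ h : ℝ) : L2 d 0 h →ₗ[ℝ] L2 d (-τ) h :=
  V d τ h ∘ₗ LinearMap.inr ℝ _ _

end V

/-! ### The operator `𝓕` -/

section F

variable {d : ℕ} {s τ h : ℝ} {C : ℝ → ℝ → Matrix (Fin d) (Fin d) ℝ}

/-- Hypothesis (H1): `C ∈ L^∞([s, s+h] × [-τ, 0], ℝ^{d×d})`. -/
def HypH1 (s τ h : ℝ) (C : ℝ → ℝ → Matrix (Fin d) (Fin d) ℝ) : Prop :=
  ∀ i j, MemLp (fun p : ℝ × ℝ => C p.1 p.2 i j) ∞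
    (volume.restrict (Icc s (s + h) ×ˢ Icc (-τ) 0))

/-- Pointwise formula of `𝓕`: the function `t ↦ ∫_{-τ}^0 C(s+t, θ) v(t+θ) dθ`. -/
def delayIntegral (s τ : ℝ) (C : ℝ → ℝ → Matrix (Fin d) (Fin d) ℝ) (v : ℝ → Vec d) (t : ℝ) :
    Vec d :=
  ∫ θ in Icc (-τ) 0, (C (s + t) θ).toEuclideanLin (v (t + θ))

theorem leb_prod (τ h : ℝ) :
    (leb 0 h).prod (leb (-τ) 0) = volume.restrict (Icc 0 h ×ˢ Icc (-τ) 0) := by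
  rw [leb, leb, Measure.prod_restrict]; rfl

theorem shift_measurePreserving (s τ h : ℝ) :
    MeasurePreserving (fun p : ℝ × ℝ => (s + p.1, p.2)) ((leb 0 h).prod (leb (-τ) 0))
      (volume.restrict (Icc s (s + h) ×ˢ Icc (-τ) 0)) := by
  have h1 : MeasurePreserving (fun p : ℝ × ℝ => (s + p.1, p.2)) volume volume :=
    (measurePreserving_add_left volume s).prod (MeasurePreserving.id volume)
  have h2 := h1.restrict_preimage (s := Icc s (s + h) ×ˢ Icc (-τ) 0)
    (measurableSet_Icc.prod measurableSet_Icc)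
  have hpre : (fun p : ℝ × ℝ => (s + p.1, p.2)) ⁻¹' (Icc s (s + h) ×ˢ Icc (-τ) 0) =
      Icc 0 h ×ˢ Icc (-τ) 0 := by
    ext ⟨a, b⟩
    simp
  rw [hpre] at h2
  rw [leb_prod]
  exact h2

theorem HypH1.memLp_shift (hC : HypH1 s τ h C) (i j : Fin d) :
    MemLp (fun p : ℝ × ℝ => C (s + p.1) p.2 i j) ∞ ((leb 0 h).prod (leb (-τ) 0)) :=
  (hC i j).comp_measurePreserving (shift_measurePreserving s τ h)

theorem HypH1.exists_bound (hC : HypH1 s τ h C) :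
    ∃ K : ℝ, 0 ≤ K ∧ ∀ᵐ t ∂(leb 0 h), ∀ᵐ θ ∂(leb (-τ) 0), ∀ i j, |C (s + t) θ i j| ≤ K := by
  have hb : ∀ i j, ∃ K : ℝ, ∀ᵐ p ∂((leb 0 h).prod (leb (-τ) 0)), |C (s + p.1) p.2 i j| ≤ K := by
    intro i j
    refine ⟨(eLpNormEssSup (fun p : ℝ × ℝ => C (s + p.1) p.2 i j)
      ((leb 0 h).prod (leb (-τ) 0))).toReal, ?_⟩
    have hfin : eLpNormEssSup (fun p : ℝ × ℝ => C (s + p.1) p.2 i j)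
      ((leb 0 h).prod (leb (-τ) 0)) ≠ ∞ := by
      have := (hC.memLp_shift i j).2
      rw [eLpNorm_exponent_top] at this
      exact this.ne
    filter_upwards [enorm_ae_le_eLpNormEssSup (fun p : ℝ × ℝ => C (s + p.1) p.2 i j)
      ((leb 0 h).prod (leb (-τ) 0))] with p hp
    rw [← Real.norm_eq_abs, ← toReal_enorm]
    exact ENNReal.toReal_mono hfin hp
  choose K hK using hb
  refine ⟨∑ i, ∑ j, |K i j|, by positivity, ?_⟩
  have hall : ∀ᵐ p ∂((leb 0 h).prod (leb (-τ) 0)), ∀ i j, |C (s + p.1) p.2 i j| ≤ K i j := by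
    simp only [ae_all_iff]; exact hK
  filter_upwards [Measure.ae_ae_of_ae_prod hall] with t ht
  filter_upwards [ht] with θ hθ i j
  calc |C (s + t) θ i j| ≤ K i j := hθ i j
    _ ≤ |K i j| := le_abs_self _
    _ ≤ ∑ j, |K i j| :=
      Finset.single_le_sum (f := fun j => |K i j|) (fun _ _ => abs_nonneg _) (Finset.mem_univ j)
    _ ≤ ∑ i, ∑ j, |K i j| :=
      Finset.single_le_sum (f := fun i => ∑ j, |K i j|)
        (fun _ _ => Finset.sum_nonneg fun _ _ => abs_nonneg _) (Finset.mem_univ i)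

theorem toEuclideanLin_eq_sum (A : Matrix (Fin d) (Fin d) ℝ) (x : Vec d) :
    A.toEuclideanLin x = ∑ i, ∑ j, (A i j * x j) • EuclideanSpace.single i (1 : ℝ) := by
  ext k
  simp [Matrix.mulVec, dotProduct, Finset.sum_apply, Pi.single_apply]

theorem norm_toEuclideanLin_le (A : Matrix (Fin d) (Fin d) ℝ) (x : Vec d) {K : ℝ}
    (hA : ∀ i j, |A i j| ≤ K) : ‖A.toEuclideanLin x‖ ≤ (d * (d * K)) * ‖x‖ := by
  rw [toEuclideanLin_eq_sum]
  have hterm : ∀ i j, ‖(A i j * x j) • EuclideanSpace.single i (1 : ℝ)‖ ≤ K * ‖x‖ := by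
    intro i j
    rw [norm_smul, PiLp.norm_single, norm_one, mul_one, norm_mul]
    exact mul_le_mul (hA i j) (PiLp.norm_apply_le x j) (norm_nonneg _)
      ((abs_nonneg _).trans (hA i j))
  calc _ ≤ ∑ i : Fin d, ∑ j : Fin d, K * ‖x‖ :=
        (norm_sum_le _ _).trans (Finset.sum_le_sum fun i _ =>
          (norm_sum_le _ _).trans (Finset.sum_le_sum fun j _ => hterm i j))
    _ = _ := by simp; ring

theorem HypH1.aestronglyMeasurable (hC : HypH1 s τ h C) (v : L2 d (-τ) h) :
    AEStronglyMeasurable (fun p : ℝ × ℝ => (C (s + p.1) p.2).toEuclideanLin (v (p.1 + p.2)))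
      ((leb 0 h).prod (leb (-τ) 0)) := by
  simp only [toEuclideanLin_eq_sum]
  refine Finset.aestronglyMeasurable_fun_sum _ fun i _ =>
    Finset.aestronglyMeasurable_fun_sum _ fun j _ => ?_
  refine AEStronglyMeasurable.smul_const (AEStronglyMeasurable.mul (hC.memLp_shift i j).1 ?_) _
  have h1 : StronglyMeasurable fun p : ℝ × ℝ => v (p.1 + p.2) :=
    (Lp.stronglyMeasurable v).comp_measurable (measurable_fst.add measurable_snd)
  exact ((EuclideanSpace.proj (𝕜 := ℝ) j).continuous.comp_stronglyMeasurable h1).aestronglyMeasurable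

theorem translate_measurePreserving (τ t : ℝ) :
    MeasurePreserving (fun θ : ℝ => t + θ) (leb (-τ) 0) (leb (t - τ) t) := by
  have h2 := (measurePreserving_add_left volume t).restrict_preimage (s := Icc (t - τ) t)
    measurableSet_Icc
  have hpre : (fun θ : ℝ => t + θ) ⁻¹' Icc (t - τ) t = Icc (-τ) 0 := by
    ext x
    simp [sub_eq_add_neg]
  rw [hpre] at h2
  exact h2

theorem leb_translate_le {t : ℝ} (ht : t ∈ Icc 0 h) : leb (t - τ) t ≤ leb (-τ) h :=
  Measure.restrict_mono (Icc_subset_Icc (by linarith [ht.1]) ht.2) le_rfl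

theorem integrable_L2 (v : L2 d (-τ) h) : Integrable v (leb (-τ) h) :=
  (Lp.memLp v).integrable (by norm_num)

theorem integrable_translate (v : L2 d (-τ) h) {t : ℝ} (ht : t ∈ Icc 0 h) :
    Integrable (fun θ => v (t + θ)) (leb (-τ) 0) :=
  (translate_measurePreserving τ t).integrable_comp_of_integrable
    ((integrable_L2 v).mono_measure (leb_translate_le ht))

theorem integral_translate_le (v : L2 d (-τ) h) {t : ℝ} (ht : t ∈ Icc 0 h) :
    ∫ θ, ‖v (t + θ)‖ ∂(leb (-τ) 0) ≤ ∫ u, ‖v u‖ ∂(leb (-τ) h) := by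
  have h1 := (translate_measurePreserving τ t).integral_comp
    (measurableEmbedding_addLeft t) (fun u => ‖v u‖)
  rw [h1]
  exact integral_mono_measure (leb_translate_le ht)
    (Filter.Eventually.of_forall fun _ => norm_nonneg _) (integrable_L2 v).norm

theorem HypH1.ae_integrable (hC : HypH1 s τ h C) (v : L2 d (-τ) h) :
    ∀ᵐ t ∂(leb 0 h), Integrable (fun θ => (C (s + t) θ).toEuclideanLin (v (t + θ)))
      (leb (-τ) 0) := by
  obtain ⟨K, -, hK⟩ := hC.exists_bound
  filter_upwards [hK, (hC.aestronglyMeasurable v).prodMk_left,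
    ae_restrict_mem measurableSet_Icc] with t hKt hmt ht
  refine ((integrable_translate v ht).norm.const_mul (d * (d * K))).mono' hmt ?_
  filter_upwards [hKt] with θ hθ
  exact norm_toEuclideanLin_le _ _ hθ

theorem HypH1.memLp_delayIntegral (hC : HypH1 s τ h C) (v : L2 d (-τ) h) :
    MemLp (delayIntegral s τ C v) 2 (leb 0 h) := by
  obtain ⟨K, hK0, hK⟩ := hC.exists_bound
  refine MemLp.of_bound (hC.aestronglyMeasurable v).integral_prod_right'
    ((d * (d * K)) * ∫ u, ‖v u‖ ∂(leb (-τ) h)) ?_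
  filter_upwards [hK, ae_restrict_mem measurableSet_Icc] with t hKt ht
  calc ‖delayIntegral s τ C v t‖
      ≤ ∫ θ, (d * (d * K)) * ‖v (t + θ)‖ ∂(leb (-τ) 0) := by
        refine norm_integral_le_of_norm_le ((integrable_translate v ht).norm.const_mul _) ?_
        filter_upwards [hKt] with θ hθ
        exact norm_toEuclideanLin_le _ _ hθ
    _ = (d * (d * K)) * ∫ θ, ‖v (t + θ)‖ ∂(leb (-τ) 0) := integral_const_mul _ _
    _ ≤ _ := mul_le_mul_of_nonneg_left (integral_translate_le v ht) (by positivity)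

theorem delayIntegral_congr {v v' : ℝ → Vec d} (hv : v =ᵐ[leb (-τ) h] v') {t : ℝ}
    (ht : t ∈ Icc 0 h) : delayIntegral s τ C v t = delayIntegral s τ C v' t := by
  refine integral_congr_ae ?_
  have := (translate_measurePreserving τ t).quasiMeasurePreserving.ae
    (ae_mono (leb_translate_le ht) hv)
  filter_upwards [this] with θ hθ
  simp only [hθ]

/-- The operator `𝓕 : X^± → X⁺`, `𝓕 v (t) = ∫_{-τ}^0 C(s+t, θ) v(t+θ) dθ`, well defined
under (H1). -/
def F (hC : HypH1 s τ h C) : L2 d (-τ) h →ₗ[ℝ] L2 d 0 h where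
  toFun v := (hC.memLp_delayIntegral v).toLp (delayIntegral s τ C v)
  map_add' v w := by
    rw [← MemLp.toLp_add, MemLp.toLp_eq_toLp_iff]
    filter_upwards [hC.ae_integrable v, hC.ae_integrable w,
      ae_restrict_mem measurableSet_Icc] with t hv hw ht
    rw [delayIntegral_congr (Lp.coeFn_add v w) ht]
    simp only [delayIntegral, Pi.add_apply, map_add]
    exact integral_add hv hw
  map_smul' c v := by
    rw [RingHom.id_apply, ← MemLp.toLp_const_smul, MemLp.toLp_eq_toLp_iff]
    filter_upwards [ae_restrict_mem measurableSet_Icc] with t ht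
    rw [delayIntegral_congr (Lp.coeFn_smul c v) ht]
    simp only [delayIntegral, Pi.smul_apply, map_smul]
    exact integral_smul c _

/-- The operator `𝓕 V⁺ : X⁺ → X⁺`. -/
def FVplus (hC : HypH1 s τ h C) : L2 d 0 h →ₗ[ℝ] L2 d 0 h := F hC ∘ₗ Vplus d τ h

/-- The operator `𝓕 V⁻ : X → X⁺`. -/
def FVminus (hC : HypH1 s τ h C) : L2 d (-τ) 0 →ₗ[ℝ] L2 d 0 h := F hC ∘ₗ Vminus d τ h

end F

/-! ### The Sobolev space `H¹([0, h], ℝ^d)` -/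

section Sobolev

variable {d : ℕ} {h : ℝ}

/-- `g` is a weak derivative of `w` on `(0, h)`. -/
def HasWeakDeriv (w g : L2 d 0 h) : Prop :=
  ∀ ψ : ℝ → ℝ, ContDiff ℝ (⊤ : ℕ∞) ψ → HasCompactSupport ψ → tsupport ψ ⊆ Ioo 0 h →
    ∫ t in Icc 0 h, deriv ψ t • w t = - ∫ t in Icc 0 h, ψ t • g t

theorem integrable_test {ψ : ℝ → ℝ} (hψ : Continuous ψ) (hc : HasCompactSupport ψ)
    (w : L2 d 0 h) : Integrable (fun t => ψ t • w t) (leb 0 h) := by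
  obtain ⟨K, hK⟩ := hψ.bounded_above_of_compact_support hc
  exact ((Lp.memLp w).integrable (by norm_num)).bdd_smul K hψ.aestronglyMeasurable
    (Filter.Eventually.of_forall hK)

theorem integral_test_add (ψ : ℝ → ℝ) (hψ : Continuous ψ) (hc : HasCompactSupport ψ)
    (w w' : L2 d 0 h) : ∫ t in Icc 0 h, ψ t • (w + w' : L2 d 0 h) t =
      (∫ t in Icc 0 h, ψ t • w t) + ∫ t in Icc 0 h, ψ t • w' t := by
  rw [← integral_add (integrable_test hψ hc w) (integrable_test hψ hc w')]
  refine integral_congr_ae ?_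
  filter_upwards [Lp.coeFn_add w w'] with t ht
  rw [ht, Pi.add_apply, smul_add]

theorem integral_test_smul (ψ : ℝ → ℝ) (c : ℝ) (w : L2 d 0 h) :
    ∫ t in Icc 0 h, ψ t • (c • w : L2 d 0 h) t = c • ∫ t in Icc 0 h, ψ t • w t := by
  rw [← integral_smul]
  refine integral_congr_ae ?_
  filter_upwards [Lp.coeFn_smul c w] with t ht
  rw [ht, Pi.smul_apply, smul_comm]

/-- The Sobolev space `H¹([0, h], ℝ^d)` as a linear subspace of `X⁺ = L²([0, h], ℝ^d)`. -/
def sobolev (d : ℕ) (h : ℝ) : Submodule ℝ (L2 d 0 h) where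
  carrier := {w | ∃ g, HasWeakDeriv w g}
  zero_mem' := by
    refine ⟨0, fun ψ _ _ _ => ?_⟩
    have h0 := integral_test_smul (d := d) (h := h) (deriv ψ) 0 0
    have h1 := integral_test_smul (d := d) (h := h) ψ 0 0
    simp only [zero_smul] at h0 h1
    rw [h0, h1, neg_zero]
  add_mem' := by
    rintro w w' ⟨g, hg⟩ ⟨g', hg'⟩
    refine ⟨g + g', fun ψ h1 h2 h3 => ?_⟩
    rw [integral_test_add _ (h1.continuous_deriv (by simp)) h2.deriv,
      integral_test_add _ h1.continuous h2, hg ψ h1 h2 h3, hg' ψ h1 h2 h3, neg_add]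
  smul_mem' := by
    rintro c w ⟨g, hg⟩
    refine ⟨c • g, fun ψ h1 h2 h3 => ?_⟩
    rw [integral_test_smul, integral_test_smul, hg ψ h1 h2 h3, smul_neg]

/-- Hypothesis (H2): `𝓕 V⁺` has range contained in `H¹` and is bounded from `X⁺` to `H¹`,
the norm of `H¹` being given by `‖w‖² + ‖w'‖²` with `w'` the weak derivative. -/
def HypH2 {s τ : ℝ} {C : ℝ → ℝ → Matrix (Fin d) (Fin d) ℝ} (hC : HypH1 s τ h C) : Prop :=
  (∀ w, FVplus hC w ∈ sobolev d h) ∧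
    ∃ K : ℝ, ∀ w g, HasWeakDeriv (FVplus hC w) g →
      Real.sqrt (‖FVplus hC w‖ ^ 2 + ‖g‖ ^ 2) ≤ K * ‖w‖

end Sobolev

/-! ### Lagrange interpolation at the Legendre zeros -/

section Interpolation

variable {d : ℕ} {h : ℝ}

/-- A linear subspace `X̃⁺` of `X⁺` which contains `H¹` and whose elements can be evaluated
pointwise: to each class in `X̃⁺` is assigned, linearly, one of its representatives, which on
`[0, h]` is the continuous one whenever the class has a continuous representative. -/
structure EvaluationSpace (d : ℕ) (h : ℝ) where
  carrier : Submodule ℝ (L2 d 0 h)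
  eval : carrier →ₗ[ℝ] (ℝ → Vec d)
  eval_ae : ∀ w : carrier, eval w =ᵐ[leb 0 h] (w : L2 d 0 h)
  sobolev_le : sobolev d h ≤ carrier
  eval_of_continuousOn : ∀ (w : carrier) (g : ℝ → Vec d), ContinuousOn g (Icc 0 h) →
    (w : L2 d 0 h) =ᵐ[leb 0 h] g → EqOn (eval w) g (Icc 0 h)

/-- The Legendre polynomial of degree `N` on `[0, h]` (up to a nonzero factor): the shifted
Legendre polynomial on `[0, 1]` composed with `t ↦ t / h`. -/
def legendre (h : ℝ) (N : ℕ) : Polynomial ℝ :=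
  ((Polynomial.shiftedLegendre N).map (Int.castRingHom ℝ)).comp
    (Polynomial.C h⁻¹ * Polynomial.X)

/-- The collocation nodes `θ₁ < ⋯ < θ_N`: the zeros of the Legendre polynomial of degree `N`
on `[0, h]`. -/
def nodes (h : ℝ) (N : ℕ) : Finset ℝ := (legendre h N).roots.toFinset

/-- The Lagrange polynomial of the node `θ`. -/
def lagrangePoly (h : ℝ) (N : ℕ) (θ : ℝ) : Polynomial ℝ := Lagrange.basis (nodes h N) id θ

/-- The function `t ↦ ∑_θ ℓ_θ(t) f(θ)` interpolating `f` at the nodes. -/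
def interpFun (h : ℝ) (N : ℕ) (f : ℝ → Vec d) (t : ℝ) : Vec d :=
  ∑ θ ∈ nodes h N, (lagrangePoly h N θ).eval t • f θ

theorem memLp_interpFun (N : ℕ) (f : ℝ → Vec d) : MemLp (interpFun h N f) 2 (leb 0 h) := by
  have hc : Continuous (interpFun h N f) := by
    unfold interpFun
    exact continuous_finsetSum _ fun θ _ => (Polynomial.continuous _).smul continuous_const
  obtain ⟨K, hK⟩ := (isCompact_Icc (a := (0 : ℝ)) (b := h)).exists_bound_of_continuousOn
    hc.continuousOn
  refine MemLp.of_bound hc.aestronglyMeasurable K ?_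
  filter_upwards [ae_restrict_mem measurableSet_Icc] with t ht using hK t ht

/-- The Lagrange interpolation operator `𝓛_N⁺ : X̃⁺ → X⁺`. -/
def interp (Y : EvaluationSpace d h) (N : ℕ) : Y.carrier →ₗ[ℝ] L2 d 0 h where
  toFun w := (memLp_interpFun N (Y.eval w)).toLp (interpFun h N (Y.eval w))
  map_add' v w := by
    rw [← MemLp.toLp_add, MemLp.toLp_eq_toLp_iff]
    refine Filter.Eventually.of_forall fun t => ?_
    simp [interpFun, Finset.sum_add_distrib]
  map_smul' c w := by
    rw [RingHom.id_apply, ← MemLp.toLp_const_smul, MemLp.toLp_eq_toLp_iff]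
    refine Filter.Eventually.of_forall fun t => ?_
    simp [interpFun, Finset.smul_sum, smul_comm c]

end Interpolation

/-! ### The equations -/

section Equations

variable {d : ℕ} {s τ h : ℝ} {C : ℝ → ℝ → Matrix (Fin d) (Fin d) ℝ}

/-- The operator `I - 𝓕 V⁺ : X⁺ → X⁺`. -/
def exactOp (hC : HypH1 s τ h C) : L2 d 0 h →ₗ[ℝ] L2 d 0 h :=
  LinearMap.id - FVplus hC

/-- The operator `I - 𝓛_N⁺ 𝓕 V⁺ : X⁺ → X⁺`, defined since the range of `𝓕 V⁺` lies
in `H¹ ⊆ X̃⁺`. -/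
def collocationOp {hC : HypH1 s τ h C} (hF : HypH2 hC) (Y : EvaluationSpace d h) (N : ℕ) :
    L2 d 0 h →ₗ[ℝ] L2 d 0 h :=
  LinearMap.id - interp Y N ∘ₗ
    (FVplus hC).codRestrict Y.carrier fun w => Y.sobolev_le (hF.1 w)

/-- The bounded operator `S` is the two-sided inverse of the linear operator `A`. -/
def IsBoundedInverse (A : L2 d 0 h →ₗ[ℝ] L2 d 0 h) (S : L2 d 0 h →L[ℝ] L2 d 0 h) : Prop :=
  (∀ w, S (A w) = w) ∧ ∀ w, A (S w) = w

/-- The fixed point equation `w = 𝓕 V(φ, w)`. -/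
def IsFixedPoint (hC : HypH1 s τ h C) (φ : L2 d (-τ) 0) (w : L2 d 0 h) : Prop :=
  w = F hC (V d τ h (φ, w))

/-- The collocation equation `w = 𝓛_N⁺ 𝓕 V(φ, w)`, including that the right-hand side is
meaningful. -/
def IsCollocationSolution (hC : HypH1 s τ h C) (Y : EvaluationSpace d h) (N : ℕ)
    (φ : L2 d (-τ) 0) (w : L2 d 0 h) : Prop :=
  ∃ hm : F hC (V d τ h (φ, w)) ∈ Y.carrier, w = interp Y N ⟨F hC (V d τ h (φ, w)), hm⟩

end Equations

end RenewalCollocation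

end

open RenewalCollocation

namespace RenewalCollocation

open MeasureTheory Set
open scoped ENNReal

/-! Everything follows once `𝓛_N⁺ 𝓕 V⁺ → 𝓕 V⁺` in operator norm on `X⁺`: a Neumann series then
inverts `I - 𝓛_N⁺ 𝓕 V⁺`, with inverse at most twice as large as that of `I - 𝓕 V⁺`. The error bound
comes from the identity `(I - 𝓛_N⁺ 𝓕 V⁺)(w_N* - w*) = 𝓛_N⁺ w* - w*`.

Invertibility of `I - 𝓕 V⁺` is a Volterra argument. Since `V⁺ w` vanishes at nonpositive times, `‖𝓕
V⁺ w(t)‖ ≤ M ∫_0^t ‖w‖` (`exists_norm_FVplus_le`). Iterating produces factorials, so some power of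
`𝓕 V⁺` has norm below 1.

The convergence rests on three facts. By (H2), `𝓕 V⁺ w` has a weak derivative of norm at most a
constant times `‖w‖`, hence a 1/2-Hölder representative with a constant of that size
(`HasWeakDeriv.exists_representative`). By Gauss quadrature, the Lagrange polynomials at the
Legendre zeros are orthogonal in `L²`, with squared norms adding up to `h`, so interpolation is
bounded by `√h` from the uniform norm to `L²` (`integral_norm_interpFun_sq_le`). Finally, a
Bernstein polynomial approximates a Hölder function uniformly with an error controlled by the Hölder
constant alone, and interpolation reproduces it as soon as `N` exceeds its degree. Together these
give convergence uniform over the unit ball of `X⁺`. -/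

/-! ### Zeros of the Legendre polynomials -/

open Polynomial in
theorem iterate_derivative_comp_C_mul_X (p : ℝ[X]) (a : ℝ) (n : ℕ) :
    derivative^[n] (p.comp (C a * X)) = C (a ^ n) * (derivative^[n] p).comp (C a * X) := by
  induction n with
  | zero => simp
  | succ n ih =>
    rw [Function.iterate_succ_apply', ih, Function.iterate_succ_apply', derivative_C_mul,
      derivative_comp]
    simp only [derivative_C_mul, derivative_X, mul_one, pow_succ, C_mul]
    ring

/-- The polynomial whose `N`-th derivative is, up to a factor, the Legendre polynomial of degree
`N` on `[0, h]`. -/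
noncomputable def rodrigues (h : ℝ) (N : ℕ) : Polynomial ℝ :=
  ((Polynomial.X : Polynomial ℝ) ^ N * (1 - (Polynomial.X : Polynomial ℝ)) ^ N).comp (Polynomial.C h⁻¹ * Polynomial.X)

-- Rodrigues' formula on `[0, h]`: the factor `h ^ N` cancels the `h⁻¹ ^ N` that the chain rule
-- produces.
open Polynomial in
theorem legendre_eq_rodrigues {h : ℝ} (hh : 0 < h) (N : ℕ) :
    legendre h N = C ((N.factorial : ℝ)⁻¹ * h ^ N) * derivative^[N] (rodrigues h N) := by
  have h1 := congrArg (Polynomial.map (Int.castRingHom ℝ)) (factorial_mul_shiftedLegendre_eq N)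
  rw [← iterate_derivative_map] at h1
  simp only [Polynomial.map_mul, Polynomial.map_pow, Polynomial.map_sub, Polynomial.map_one,
    Polynomial.map_X, Polynomial.map_natCast] at h1
  rw [rodrigues, iterate_derivative_comp_C_mul_X, ← h1, legendre, mul_comp, natCast_comp,
    ← C_eq_natCast, ← mul_assoc, ← mul_assoc, ← C_mul, ← C_mul]
  have : (N.factorial : ℝ)⁻¹ * h ^ N * h⁻¹ ^ N * (N.factorial : ℝ) = 1 := by
    have := N.factorial_ne_zero
    have hpow : h ^ N ≠ 0 := pow_ne_zero _ hh.ne'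
    rw [inv_pow]
    field_simp
  rw [this, C_1, one_mul]

-- Each differentiation lowers the order of a zero by at most one, so after `j < N` of them a factor
-- `X ^ (N - j)`, respectively `(1 - X) ^ (N - j)`, survives.
open Polynomial in
theorem eval_iterate_derivative_rodrigues {h : ℝ} (hh : 0 < h) {N j : ℕ} (hj : j < N) :
    (derivative^[j] (rodrigues h N)).eval 0 = 0 ∧ (derivative^[j] (rodrigues h N)).eval h = 0 := by
  have hN : N - j ≠ 0 := by omega
  rw [rodrigues, iterate_derivative_comp_C_mul_X]
  constructor
  · obtain ⟨u, hu⟩ := pow_sub_dvd_iterate_derivative_of_pow_dvd j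
      (Dvd.intro _ rfl : (X : ℝ[X]) ^ N ∣ X ^ N * (1 - X) ^ N)
    rw [hu]; simp [hN]
  · obtain ⟨u, hu⟩ := pow_sub_dvd_iterate_derivative_of_pow_dvd j
      (Dvd.intro_left _ rfl : (1 - X : ℝ[X]) ^ N ∣ X ^ N * (1 - X) ^ N)
    rw [hu]; simp [hN, hh.ne']

/-- Iterated Rolle theorem for a polynomial with zeros of order `N` at both ends. -/
theorem exists_roots_iterate_derivative (p : Polynomial ℝ) {a b : ℝ} (hab : a < b) (N : ℕ)
    (hp : ∀ j < N, (Polynomial.derivative^[j] p).eval a = 0 ∧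
      (Polynomial.derivative^[j] p).eval b = 0) :
    ∃ x : Fin N → ℝ, StrictMono x ∧
      ∀ i, x i ∈ Ioo a b ∧ (Polynomial.derivative^[N] p).eval (x i) = 0 := by
  induction N with
  | zero => exact ⟨Fin.elim0, fun i => i.elim0, fun i => i.elim0⟩
  | succ N ih =>
    obtain ⟨x, hx, hx'⟩ := ih fun j hj => hp j (hj.trans (Nat.lt_succ_self N))
    set q := Polynomial.derivative^[N] p with hq
    -- The `N` interior zeros already found and the two endpoints give `N + 2` zeros of `q`; Rolle
    -- then yields one zero of its derivative in each of the `N + 1` gaps.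
    obtain ⟨z, hz, hz0, hzI⟩ : ∃ z : Fin (N + 2) → ℝ, StrictMono z ∧ (∀ i, q.eval (z i) = 0) ∧
        ∀ i, z i ∈ Icc a b := by
      refine ⟨Fin.snoc (α := fun _ => ℝ) (Fin.cons (α := fun _ => ℝ) a x) b, ?_, ?_, ?_⟩
      · rw [Fin.strictMono_iff_lt_succ]
        intro i
        induction i using Fin.lastCases with
        | last =>
          rw [Fin.succ_last, Fin.snoc_last, Fin.snoc_castSucc]
          cases N with
          | zero => simpa using hab
          | succ N => rw [← Fin.succ_last, Fin.cons_succ]; exact (hx' _).1.2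
        | cast i =>
          rw [Fin.succ_castSucc, Fin.snoc_castSucc, Fin.snoc_castSucc, Fin.cons_succ]
          cases N with
          | zero => exact i.elim0
          | succ N =>
            induction i using Fin.cases with
            | zero => exact (hx' _).1.1
            | succ i =>
              rw [← Fin.succ_castSucc, Fin.cons_succ]
              exact hx (Fin.castSucc_lt_succ)
      · intro i
        induction i using Fin.lastCases with
        | last => rw [Fin.snoc_last]; exact (hp N (Nat.lt_succ_self N)).2
        | cast i =>
          rw [Fin.snoc_castSucc]
          induction i using Fin.cases with
          | zero => exact (hp N (Nat.lt_succ_self N)).1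
          | succ i => exact (hx' i).2
      · intro i
        induction i using Fin.lastCases with
        | last => rw [Fin.snoc_last]; exact right_mem_Icc.2 hab.le
        | cast i =>
          rw [Fin.snoc_castSucc]
          induction i using Fin.cases with
          | zero => exact left_mem_Icc.2 hab.le
          | succ i => exact Ioo_subset_Icc_self (hx' i).1
    have hex : ∀ i : Fin (N + 1), ∃ y ∈ Ioo (z i.castSucc) (z i.succ),
        (Polynomial.derivative q).eval y = 0 := by
      intro i
      exact exists_hasDerivAt_eq_zero (hz Fin.castSucc_lt_succ) q.continuous.continuousOn
        (by rw [hz0, hz0]) fun y _ => q.hasDerivAt y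
    choose y hy hy0 using hex
    refine ⟨y, ?_, fun i => ⟨⟨(hzI _).1.trans_lt (hy i).1, (hy i).2.trans_le (hzI _).2⟩, ?_⟩⟩
    · intro i j hij
      exact (hy i).2.trans_le ((hz.monotone (Fin.succ_le_castSucc_iff.2 hij)).trans (hy j).1.le)
    · rw [Function.iterate_succ_apply']; exact hy0 i

open Polynomial in
theorem natDegree_legendre {h : ℝ} (hh : 0 < h) (N : ℕ) : (legendre h N).natDegree = N := by
  rw [legendre, natDegree_comp, natDegree_C_mul_X _ (inv_ne_zero hh.ne'), mul_one,
    natDegree_map_eq_of_injective (RingHom.injective_int _), natDegree_shiftedLegendre]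

open Polynomial in
theorem legendre_ne_zero {h : ℝ} (hh : 0 < h) (N : ℕ) : legendre h N ≠ 0 := by
  rcases Nat.eq_zero_or_pos N with rfl | hN
  · simp [legendre, shiftedLegendre]
  · exact ne_zero_of_natDegree_gt (n := 0) (by rwa [natDegree_legendre hh])

/-- Iterated Rolle provides `N` distinct interior zeros and the degree allows no others, so
discarding multiplicities in `nodes` loses nothing. -/
theorem nodes_spec {h : ℝ} (hh : 0 < h) (N : ℕ) :
    (nodes h N).card = N ∧ ∀ θ ∈ nodes h N, θ ∈ Ioo 0 h := by
  obtain ⟨x, hx, hx'⟩ := exists_roots_iterate_derivative (rodrigues h N) hh N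
    fun j hj => eval_iterate_derivative_rodrigues hh hj
  have hsub : Finset.univ.image x ⊆ nodes h N := by
    intro t ht
    obtain ⟨i, -, rfl⟩ := Finset.mem_image.1 ht
    rw [nodes, Multiset.mem_toFinset, Polynomial.mem_roots (legendre_ne_zero hh N),
      Polynomial.IsRoot, legendre_eq_rodrigues hh, Polynomial.eval_mul, (hx' i).2, mul_zero]
  have hcard : (Finset.univ.image x).card = N := by
    rw [Finset.card_image_of_injective _ hx.injective, Finset.card_fin]
  have hle : (nodes h N).card ≤ N := by
    calc (nodes h N).card ≤ (legendre h N).roots.card := Multiset.toFinset_card_le _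
      _ ≤ (legendre h N).natDegree := Polynomial.card_roots' _
      _ = N := natDegree_legendre hh N
  have heq := Finset.eq_of_subset_of_card_le hsub (hle.trans hcard.ge)
  refine ⟨by rw [← heq, hcard], fun θ hθ => ?_⟩
  rw [← heq] at hθ
  obtain ⟨i, -, rfl⟩ := Finset.mem_image.1 hθ
  exact (hx' i).1

theorem card_nodes {h : ℝ} (hh : 0 < h) (N : ℕ) : (nodes h N).card = N := (nodes_spec hh N).1

theorem nodes_mem_Icc {h : ℝ} (hh : 0 < h) {N : ℕ} {θ : ℝ} (hθ : θ ∈ nodes h N) :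
    θ ∈ Icc 0 h := Ioo_subset_Icc_self ((nodes_spec hh N).2 θ hθ)

/-! ### Orthogonality and Gauss quadrature -/

/-- The `N`-th derivative of a polynomial with zeros of order `N` at `a` and `b` is orthogonal to
the polynomials of degree less than `N`. -/
theorem integral_iterate_derivative_mul_eq_zero (p : Polynomial ℝ) {a b : ℝ} (N : ℕ)
    (hp : ∀ j < N, (Polynomial.derivative^[j] p).eval a = 0 ∧
      (Polynomial.derivative^[j] p).eval b = 0) (q : Polynomial ℝ) (hq : q.degree < N) :
    ∫ t in a..b, (Polynomial.derivative^[N] p).eval t * q.eval t = 0 := by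
  -- Integration by parts moves one derivative onto `q`: the boundary terms vanish and the degree of
  -- `q` drops. At `N = 0` the degree bound forces `q = 0`.
  induction N generalizing q with
  | zero =>
    have : q = 0 := by
      by_contra h0
      have := Polynomial.zero_le_degree_iff.2 h0
      exact absurd hq (not_lt.2 (by simpa using this))
    simp [this]
  | succ N ih =>
    rw [Function.iterate_succ_apply']
    have hq' : (Polynomial.derivative q).degree < N := by
      by_cases h0 : Polynomial.derivative q = 0
      · rw [h0, Polynomial.degree_zero]; exact WithBot.bot_lt_coe N
      have hq0 : q ≠ 0 := fun h => h0 (by simp [h])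
      have h1 := Polynomial.degree_derivative_lt hq0
      rw [Polynomial.degree_eq_natDegree hq0] at hq h1
      rw [Polynomial.degree_eq_natDegree h0] at h1 ⊢
      norm_cast at hq h1 ⊢
      omega
    have hparts := intervalIntegral.integral_mul_deriv_eq_deriv_mul (a := a) (b := b)
      (fun t _ => q.hasDerivAt t) (fun t _ => (Polynomial.derivative^[N] p).hasDerivAt t)
      ((Polynomial.continuous _).intervalIntegrable a b)
      ((Polynomial.continuous _).intervalIntegrable a b)
    have h0 := ih (fun j hj => hp j (hj.trans (Nat.lt_succ_self N))) _ hq'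
    simp only [(hp N (Nat.lt_succ_self N)).1, (hp N (Nat.lt_succ_self N)).2] at hparts
    simp only [mul_comm] at hparts h0 ⊢
    rw [hparts, h0]
    simp

theorem integral_legendre_mul_eq_zero {h : ℝ} (hh : 0 < h) {N : ℕ} {q : Polynomial ℝ}
    (hq : q.degree < N) : ∫ t in (0 : ℝ)..h, (legendre h N).eval t * q.eval t = 0 := by
  have h0 := integral_iterate_derivative_mul_eq_zero (rodrigues h N) N
    (fun j hj => eval_iterate_derivative_rodrigues hh hj) q hq
  rw [legendre_eq_rodrigues hh]
  simp only [Polynomial.eval_mul, Polynomial.eval_C, mul_assoc]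
  rw [intervalIntegral.integral_const_mul, intervalIntegral.integral_const_mul, h0]
  simp

/-- A polynomial of degree less than `2N` vanishing at the `N` Legendre nodes has zero integral. -/
theorem integral_eq_zero_of_eval_nodes {h : ℝ} (hh : 0 < h) {N : ℕ} {q : Polynomial ℝ}
    (hq : q.natDegree < 2 * N) (h0 : ∀ θ ∈ nodes h N, q.eval θ = 0) :
    ∫ t in (0 : ℝ)..h, q.eval t = 0 := by
  set P := legendre h N with hP
  have hP0 : P ≠ 0 := legendre_ne_zero hh N
  have hPdeg : P.degree = N := by
    rw [Polynomial.degree_eq_natDegree hP0, hP, natDegree_legendre hh]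
  -- The remainder has degree below `N` and vanishes at `N` nodes. So `q` is `P` times a polynomial
  -- of degree below `N`, which is orthogonal to `P`.
  have hmod : q % P = 0 := by
    refine Polynomial.eq_zero_of_degree_lt_of_eval_finset_eq_zero (nodes h N) ?_ fun θ hθ => ?_
    · rw [card_nodes hh, ← hPdeg]; exact EuclideanDomain.mod_lt q hP0
    · have hPθ : P.eval θ = 0 := by
        have := Multiset.mem_toFinset.1 hθ
        exact (Polynomial.mem_roots'.1 this).2
      have := congrArg (Polynomial.eval θ) (EuclideanDomain.div_add_mod q P)
      rw [Polynomial.eval_add, Polynomial.eval_mul, hPθ, zero_mul, zero_add, h0 θ hθ] at this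
      exact this
  have hqP : q = P * (q / P) := by
    conv_lhs => rw [← EuclideanDomain.div_add_mod q P, hmod, add_zero]
  have hdeg : (q / P).degree < N := by
    by_cases hz : q / P = 0
    · rw [hz, Polynomial.degree_zero]; exact WithBot.bot_lt_coe N
    · have := congrArg Polynomial.natDegree hqP
      rw [Polynomial.natDegree_mul hP0 hz, hP, natDegree_legendre hh, ← hP] at this
      rw [Polynomial.degree_eq_natDegree hz]
      norm_cast
      omega
  rw [hqP]
  simp only [Polynomial.eval_mul]
  exact integral_legendre_mul_eq_zero hh hdeg

/-! ### Stability of Lagrange interpolation in `L²` -/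

theorem natDegree_lagrangePoly {h : ℝ} (hh : 0 < h) {N : ℕ} {θ : ℝ} (hθ : θ ∈ nodes h N) :
    (lagrangePoly h N θ).natDegree = N - 1 := by
  have := Lagrange.degree_basis (v := id) (injOn_id _) hθ
  rw [card_nodes hh] at this
  exact Polynomial.natDegree_eq_of_degree_eq_some this

theorem eval_lagrangePoly {h : ℝ} {N : ℕ} {θ η : ℝ} (hθ : θ ∈ nodes h N) (hη : η ∈ nodes h N) :
    (lagrangePoly h N θ).eval η = if θ = η then 1 else 0 := by
  split_ifs with heq
  · subst heq; exact Lagrange.eval_basis_self (v := id) (injOn_id _) hθ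
  · exact Lagrange.eval_basis_of_ne (v := id) heq hη

/-- The products of distinct Lagrange polynomials, and the differences `ℓ² - ℓ`, vanish at every
node and have degree below `2N`, so their integrals are zero. This gives orthogonality, and
nonnegative quadrature weights `∫ ℓ = ∫ ℓ²`. -/
theorem integral_lagrangePoly_mul {h : ℝ} (hh : 0 < h) {N : ℕ} {θ η : ℝ} (hθ : θ ∈ nodes h N)
    (hη : η ∈ nodes h N) : ∫ t in (0 : ℝ)..h,
      (lagrangePoly h N θ).eval t * (lagrangePoly h N η).eval t =
        if θ = η then ∫ t in (0 : ℝ)..h, (lagrangePoly h N θ).eval t else 0 := by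
  have hN : 0 < N := by rw [← card_nodes hh N]; exact Finset.card_pos.2 ⟨θ, hθ⟩
  have hd : (lagrangePoly h N θ * lagrangePoly h N η).natDegree < 2 * N := by
    refine Polynomial.natDegree_mul_le.trans_lt ?_
    rw [natDegree_lagrangePoly hh hθ, natDegree_lagrangePoly hh hη]
    omega
  split_ifs with heq
  · subst heq
    have := integral_eq_zero_of_eval_nodes hh (N := N)
      (q := lagrangePoly h N θ * lagrangePoly h N θ - lagrangePoly h N θ) ?_ ?_
    · simp only [Polynomial.eval_sub, Polynomial.eval_mul] at this
      rw [intervalIntegral.integral_sub] at this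
      · linarith
      · exact ((Polynomial.continuous _).mul (Polynomial.continuous _)).intervalIntegrable _ _
      · exact (Polynomial.continuous _).intervalIntegrable _ _
    · refine (Polynomial.natDegree_sub_le _ _).trans_lt (max_lt hd ?_)
      rw [natDegree_lagrangePoly hh hθ]; omega
    · intro ζ hζ
      rw [Polynomial.eval_sub, Polynomial.eval_mul, eval_lagrangePoly hθ hζ]
      split_ifs <;> simp
  · have := integral_eq_zero_of_eval_nodes hh hd ?_
    · simpa only [Polynomial.eval_mul] using this
    · intro ζ hζ
      rw [Polynomial.eval_mul, eval_lagrangePoly hθ hζ, eval_lagrangePoly hη hζ]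
      split_ifs with h1 h2
      · exact absurd (h1.trans h2.symm) heq
      all_goals simp

theorem integral_lagrangePoly_nonneg {h : ℝ} (hh : 0 < h) {N : ℕ} {θ : ℝ} (hθ : θ ∈ nodes h N) :
    0 ≤ ∫ t in (0 : ℝ)..h, (lagrangePoly h N θ).eval t := by
  have := integral_lagrangePoly_mul hh hθ hθ
  rw [if_pos rfl] at this
  rw [← this]
  exact intervalIntegral.integral_nonneg hh.le fun t _ => mul_self_nonneg _

theorem sum_integral_lagrangePoly {h : ℝ} (hh : 0 < h) {N : ℕ} (hN : 0 < N) :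
    ∑ θ ∈ nodes h N, ∫ t in (0 : ℝ)..h, (lagrangePoly h N θ).eval t = h := by
  rw [← intervalIntegral.integral_finsetSum
    fun θ _ => (Polynomial.continuous _).intervalIntegrable _ _]
  have hs : ∑ θ ∈ nodes h N, lagrangePoly h N θ = 1 :=
    Lagrange.sum_basis (v := id) (injOn_id _) (Finset.card_pos.1 (by rwa [card_nodes hh]))
  simp only [← Polynomial.eval_finsetSum, hs, Polynomial.eval_one]
  simp

/-- Stability of the interpolation at the Legendre nodes from the uniform norm to `L²`. -/
theorem integral_norm_interpFun_sq_le {d : ℕ} {h : ℝ} (hh : 0 < h) {N : ℕ} (hN : 0 < N)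
    (f : ℝ → Vec d) {B : ℝ} (hB : ∀ θ ∈ nodes h N, ‖f θ‖ ≤ B) :
    ∫ t in (0 : ℝ)..h, ‖interpFun h N f t‖ ^ 2 ≤ h * B ^ 2 := by
  have hexp : ∀ t, ‖interpFun h N f t‖ ^ 2 = ∑ θ ∈ nodes h N, ∑ η ∈ nodes h N,
      ((lagrangePoly h N θ).eval t * (lagrangePoly h N η).eval t) * inner ℝ (f θ) (f η) := by
    intro t
    rw [← real_inner_self_eq_norm_sq, interpFun, sum_inner]
    refine Finset.sum_congr rfl fun θ _ => ?_
    rw [inner_sum]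
    refine Finset.sum_congr rfl fun η _ => ?_
    rw [real_inner_smul_left, real_inner_smul_right, mul_assoc]
  have hcont : ∀ θ η, Continuous fun t =>
      ((lagrangePoly h N θ).eval t * (lagrangePoly h N η).eval t) * inner ℝ (f θ) (f η) :=
    fun θ η => ((Polynomial.continuous _).mul (Polynomial.continuous _)).mul continuous_const
  simp only [hexp]
  rw [intervalIntegral.integral_finsetSum fun θ _ =>
    (continuous_finsetSum _ fun η _ => hcont θ η).intervalIntegrable _ _]
  -- Orthogonality removes the off-diagonal terms; what remains is a quadrature sum with nonnegative
  -- weights of total `h`.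
  calc _ = ∑ θ ∈ nodes h N, (∫ t in (0 : ℝ)..h, (lagrangePoly h N θ).eval t) * ‖f θ‖ ^ 2 := by
        refine Finset.sum_congr rfl fun θ hθ => ?_
        rw [intervalIntegral.integral_finsetSum fun η _ => (hcont θ η).intervalIntegrable _ _]
        rw [Finset.sum_eq_single_of_mem θ hθ]
        · rw [intervalIntegral.integral_mul_const, integral_lagrangePoly_mul hh hθ hθ, if_pos rfl,
            real_inner_self_eq_norm_sq]
        · intro η hη hne
          rw [intervalIntegral.integral_mul_const, integral_lagrangePoly_mul hh hθ hη,
            if_neg hne.symm, zero_mul]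
    _ ≤ ∑ θ ∈ nodes h N, (∫ t in (0 : ℝ)..h, (lagrangePoly h N θ).eval t) * B ^ 2 := by
        refine Finset.sum_le_sum fun θ hθ => ?_
        exact mul_le_mul_of_nonneg_left (pow_le_pow_left₀ (norm_nonneg _) (hB θ hθ) 2)
          (integral_lagrangePoly_nonneg hh hθ)
    _ = h * B ^ 2 := by rw [← Finset.sum_mul, sum_integral_lagrangePoly hh hN]

/-! ### Bernstein approximation and convergence of the interpolants -/

theorem norm_sq_L2 {d : ℕ} {a b : ℝ} (u : L2 d a b) : ‖u‖ ^ 2 = ∫ t in Icc a b, ‖u t‖ ^ 2 := by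
  rw [← real_inner_self_eq_norm_sq, L2.inner_def]
  simp only [real_inner_self_eq_norm_sq]

theorem norm_L2_le_of_bound {d : ℕ} {h : ℝ} (hh : 0 < h) (u : L2 d 0 h) {B : ℝ}
    (hB : 0 ≤ B) (hu : ∀ᵐ t ∂(leb 0 h), ‖u t‖ ≤ B) : ‖u‖ ≤ √h * B := by
  refine le_of_sq_le_sq ?_ (by positivity)
  rw [norm_sq_L2, mul_pow, Real.sq_sqrt hh.le]
  calc ∫ t in Icc 0 h, ‖u t‖ ^ 2 ≤ ∫ t in Icc 0 h, B ^ 2 := by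
        refine integral_mono_of_nonneg (Filter.Eventually.of_forall fun _ => by positivity)
          (integrable_const _) ?_
        filter_upwards [hu] with t ht
        exact pow_le_pow_left₀ (norm_nonneg _) ht 2
    _ = h * B ^ 2 := by simp [hh.le]

theorem interpFun_sum_polynomial {d : ℕ} {h : ℝ} (hh : 0 < h) {N n : ℕ} (hn : n < N)
    {ι : Type*} (s : Finset ι) (p : ι → Polynomial ℝ) (hp : ∀ k ∈ s, (p k).natDegree ≤ n)
    (v : ι → Vec d) (t : ℝ) :
    interpFun h N (fun u => ∑ k ∈ s, (p k).eval u • v k) t = ∑ k ∈ s, (p k).eval t • v k := by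
  simp only [interpFun, Finset.smul_sum]
  rw [Finset.sum_comm]
  refine Finset.sum_congr rfl fun k hk => ?_
  have hd : (p k).degree < (nodes h N).card := by
    rw [card_nodes hh]
    exact (Polynomial.degree_le_of_natDegree_le (hp k hk)).trans_lt (by exact_mod_cast hn)
  have h1 := congrArg (Polynomial.eval t) (Lagrange.eq_interpolate (v := id) (injOn_id _) hd)
  rw [Lagrange.interpolate_apply, Polynomial.eval_finsetSum] at h1
  rw [h1, Finset.sum_smul]
  refine Finset.sum_congr rfl fun θ _ => ?_
  rw [smul_smul, Polynomial.eval_mul, Polynomial.eval_C, mul_comm]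
  rfl

theorem interpFun_sub {d : ℕ} {h : ℝ} (N : ℕ) (f g : ℝ → Vec d) (t : ℝ) :
    interpFun h N (fun u => f u - g u) t = interpFun h N f t - interpFun h N g t := by
  simp [interpFun, smul_sub, Finset.sum_sub_distrib]

/-- Trades the Hölder modulus for a quadratic, whose Bernstein mean is the explicitly known
variance. When `√a > δ`, use `a ^ 2 = √a * √a ^ 3`. -/
theorem sqrt_le_add_sq_div {a δ : ℝ} (ha : 0 ≤ a) (hδ : 0 < δ) : √a ≤ δ + a ^ 2 / δ ^ 3 := by
  rcases le_or_gt (√a) δ with h | h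
  · exact h.trans (le_add_of_nonneg_right (by positivity))
  · have h1 : √a * δ ^ 3 ≤ a ^ 2 := by
      calc √a * δ ^ 3 ≤ √a * √a ^ 3 := by gcongr
        _ = (√a ^ 2) ^ 2 := by ring
        _ = a ^ 2 := by rw [Real.sq_sqrt ha]
    have h2 : √a ≤ a ^ 2 / δ ^ 3 := (le_div_iff₀ (by positivity)).2 h1
    linarith

/-- The Bernstein approximation of degree `n` on `[0, h]`. -/
noncomputable def bernsteinFun {d : ℕ} (h : ℝ) (n : ℕ) (f : ℝ → Vec d) (t : ℝ) : Vec d :=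
  ∑ k : Fin (n + 1), ((bernsteinPolynomial ℝ n k).comp
    (Polynomial.C h⁻¹ * Polynomial.X)).eval t • f (h * (k / n))

theorem interpFun_bernsteinFun {d : ℕ} {h : ℝ} (hh : 0 < h) {N n : ℕ} (hn : n < N)
    (f : ℝ → Vec d) (t : ℝ) :
    interpFun h N (bernsteinFun h n f) t = bernsteinFun h n f t := by
  refine interpFun_sum_polynomial hh hn _ _ (fun k _ => ?_) _ t
  rw [Polynomial.natDegree_comp, Polynomial.natDegree_C_mul_X _ (inv_ne_zero hh.ne'), mul_one,
    bernsteinPolynomial]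
  have hk : (k : ℕ) ≤ n := k.is_le
  have h1 : ((n.choose k : Polynomial ℝ)).natDegree ≤ 0 := (Polynomial.natDegree_natCast _).le
  have h2 : ((Polynomial.X : Polynomial ℝ) ^ (k : ℕ)).natDegree ≤ k :=
    Polynomial.natDegree_X_pow_le _
  have h3 : ((1 - Polynomial.X : Polynomial ℝ) ^ (n - (k : ℕ))).natDegree ≤ (n - k) * 1 :=
    Polynomial.natDegree_pow_le_of_le _ (by compute_degree)
  have := Polynomial.natDegree_mul_le_of_le (Polynomial.natDegree_mul_le_of_le h1 h2) h3
  omega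

/-- The error is an average of `f (h * (k / n)) - f t` with the Bernstein weights. After
`sqrt_le_add_sq_div` only their total mass 1 and their variance `x * (1 - x) / n ≤ 1 / n` enter. -/
theorem norm_bernsteinFun_sub_le {d : ℕ} {h : ℝ} (hh : 0 < h) {n : ℕ} (hn : n ≠ 0) {δ : ℝ}
    (hδ : 0 < δ) {f : ℝ → Vec d} {M : ℝ} (hM : 0 ≤ M)
    (hf : ∀ t ∈ Icc 0 h, ∀ u ∈ Icc 0 h, ‖f t - f u‖ ≤ M * √|t - u|) {t : ℝ} (ht : t ∈ Icc 0 h) :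
    ‖bernsteinFun h n f t - f t‖ ≤ M * (√h * (δ + 1 / n / δ ^ 3)) := by
  have hn0 : (0 : ℝ) < n := Nat.cast_pos.2 (Nat.pos_of_ne_zero hn)
  have hxI : h⁻¹ * t ∈ Icc (0 : ℝ) 1 := by
    refine ⟨mul_nonneg (inv_nonneg.2 hh.le) ht.1, ?_⟩
    rw [inv_mul_le_iff₀ hh, mul_one]; exact ht.2
  set x : unitInterval := ⟨h⁻¹ * t, hxI⟩ with hx
  have htx : t = h * x := by rw [hx]; field_simp
  have hb : bernsteinFun h n f t = ∑ k : Fin (n + 1), bernstein n k x • f (h * (k / n)) := by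
    refine Finset.sum_congr rfl fun k _ => ?_
    congr 1
    rw [bernstein_apply, Polynomial.eval_comp, bernsteinPolynomial]
    simp [hx]
  have hone : f t = ∑ k : Fin (n + 1), bernstein n k x • f t := by
    rw [← Finset.sum_smul, bernstein.probability, one_smul]
  rw [hb]
  nth_rewrite 1 [hone]
  rw [← Finset.sum_sub_distrib]
  have hterm : ∀ k : Fin (n + 1), ‖bernstein n k x • f (h * (k / n)) - bernstein n k x • f t‖ ≤
      M * √h * (δ * bernstein n k x + (x - bernstein.z k : ℝ) ^ 2 * bernstein n k x / δ ^ 3) := by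
    intro k
    have hkI : (bernstein.z k : ℝ) ∈ Icc (0 : ℝ) 1 := (bernstein.z k).2
    have hk : (bernstein.z k : ℝ) = k / n := rfl
    have hmem : h * (k / n) ∈ Icc 0 h := by
      rw [← hk]
      exact ⟨mul_nonneg hh.le hkI.1, mul_le_of_le_one_right hh.le hkI.2⟩
    have habs : |h * (k / n) - t| = h * |(x : ℝ) - bernstein.z k| := by
      rw [hk, htx, ← mul_sub, abs_mul, abs_of_pos hh, abs_sub_comm]
    rw [← smul_sub, norm_smul, Real.norm_of_nonneg bernstein_nonneg]
    calc bernstein n k x * ‖f (h * (k / n)) - f t‖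
        ≤ bernstein n k x * (M * √|h * (k / n) - t|) :=
          mul_le_mul_of_nonneg_left (hf _ hmem _ ht) bernstein_nonneg
      _ = M * √h * bernstein n k x * √|(x : ℝ) - bernstein.z k| := by
          rw [habs, Real.sqrt_mul hh.le]; ring
      _ ≤ M * √h * bernstein n k x * (δ + |(x : ℝ) - bernstein.z k| ^ 2 / δ ^ 3) :=
          mul_le_mul_of_nonneg_left (sqrt_le_add_sq_div (abs_nonneg _) hδ)
            (mul_nonneg (by positivity) bernstein_nonneg)
      _ = _ := by rw [sq_abs]; ring
  refine (norm_sum_le _ _).trans ((Finset.sum_le_sum fun k _ => hterm k).trans ?_)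
  rw [← Finset.mul_sum, Finset.sum_add_distrib, ← Finset.mul_sum, ← Finset.sum_div,
    bernstein.probability, bernstein.variance hn, mul_one, mul_assoc]
  have hx1 : (x : ℝ) * (1 - x) ≤ 1 := by nlinarith [hxI.1, hxI.2, x.2.1, x.2.2]
  gcongr

/-- Interpolation at the Legendre nodes converges in `L²`, uniformly on Hölder balls. -/
theorem exists_norm_interpFun_sub_le {h : ℝ} (hh : 0 < h) (d : ℕ) {ε : ℝ} (hε : 0 < ε) :
    ∃ N₀ : ℕ, 0 < N₀ ∧ ∀ N, N₀ ≤ N → ∀ (w : L2 d 0 h) (f : ℝ → Vec d) (M : ℝ), 0 ≤ M →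
      (w : ℝ → Vec d) =ᵐ[leb 0 h] f →
      (∀ t ∈ Icc 0 h, ∀ u ∈ Icc 0 h, ‖f t - f u‖ ≤ M * √|t - u|) →
      ‖(memLp_interpFun (h := h) N f).toLp (interpFun h N f) - w‖ ≤ ε * M := by
  have hsq : 0 < √h := Real.sqrt_pos.2 hh
  -- With `δ = ε / (4 * h)`, the condition `1 / n ≤ δ ^ 4` gives `δ + 1 / n / δ ^ 3 ≤ 2 * δ`. The 4
  -- makes the final bound `4 * h * δ * M` equal to `ε * M`. The degree `n` depends on `ε` and `h`
  -- only.
  obtain ⟨n, hn0, hn⟩ : ∃ n : ℕ, n ≠ 0 ∧ (1 : ℝ) / n ≤ (ε / (4 * h)) ^ 4 := by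
    obtain ⟨n, hn⟩ := exists_nat_one_div_lt (show 0 < (ε / (4 * h)) ^ 4 by positivity)
    exact ⟨n + 1, n.succ_ne_zero, by push_cast; exact hn.le⟩
  refine ⟨n + 1, n.succ_pos, fun N hN w f M hM hwf hf => ?_⟩
  set δ := ε / (4 * h) with hδ
  have hδ0 : 0 < δ := by positivity
  set B := M * (√h * (2 * δ)) with hB
  have hB0 : 0 ≤ B := by positivity
  have happ : ∀ t ∈ Icc 0 h, ‖bernsteinFun h n f t - f t‖ ≤ B := by
    intro t ht
    refine (norm_bernsteinFun_sub_le hh hn0 hδ0 hM hf ht).trans ?_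
    have : (1 : ℝ) / n / δ ^ 3 ≤ δ := by
      rw [div_le_iff₀ (by positivity)]
      calc _ ≤ δ ^ 4 := hn
        _ = _ := by ring
    rw [hB]
    gcongr
    linarith
  set p := bernsteinFun h n f with hp
  have hpLp : MemLp p 2 (leb 0 h) := by
    have := memLp_interpFun (h := h) N p
    rwa [show interpFun h N p = p from funext fun t =>
      interpFun_bernsteinFun hh (Nat.lt_of_succ_le hN) f t] at this
  set g : ℝ → Vec d := fun u => f u - p u with hg
  -- Since `p` is reproduced, the error is the interpolant of `f - p` plus `p - f`; stability
  -- handles the first term and the uniform bound the second.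
  have hdecomp : (memLp_interpFun (h := h) N f).toLp (interpFun h N f) - w =
      (memLp_interpFun (h := h) N g).toLp (interpFun h N g) + (hpLp.toLp p - w) := by
    have : (memLp_interpFun (h := h) N f).toLp (interpFun h N f) =
        (memLp_interpFun (h := h) N g).toLp (interpFun h N g) + hpLp.toLp p := by
      rw [← MemLp.toLp_add, MemLp.toLp_eq_toLp_iff]
      refine Filter.Eventually.of_forall fun t => ?_
      rw [Pi.add_apply, hg, interpFun_sub, hp, interpFun_bernsteinFun hh (Nat.lt_of_succ_le hN)]
      simp
    rw [this, add_sub_assoc]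
  have h1 : ‖(memLp_interpFun (h := h) N g).toLp (interpFun h N g)‖ ≤ √h * B := by
    refine le_of_sq_le_sq ?_ (by positivity)
    rw [norm_sq_L2, mul_pow, Real.sq_sqrt hh.le]
    have hint := integral_norm_interpFun_sq_le hh (n.succ_pos.trans_le hN) g (B := B)
      fun θ hθ => by
        rw [hg, norm_sub_rev]; exact happ θ (nodes_mem_Icc hh hθ)
    rw [intervalIntegral.integral_of_le hh.le, ← integral_Icc_eq_integral_Ioc] at hint
    refine le_trans (le_of_eq (integral_congr_ae ?_)) hint
    filter_upwards [(memLp_interpFun (h := h) N g).coeFn_toLp] with t ht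
    rw [ht]
  have h2 : ‖hpLp.toLp p - w‖ ≤ √h * B := by
    refine norm_L2_le_of_bound hh _ hB0 ?_
    filter_upwards [Lp.coeFn_sub (hpLp.toLp p) w, hpLp.coeFn_toLp, hwf,
      ae_restrict_mem measurableSet_Icc] with t e1 e2 e3 ht
    rw [e1, Pi.sub_apply, e2, e3]
    exact happ t ht
  rw [hdecomp]
  refine (norm_add_le _ _).trans ((add_le_add h1 h2).trans (le_of_eq ?_))
  have hss : √h * √h = h := Real.mul_self_sqrt hh.le
  calc √h * B + √h * B = 4 * (√h * √h) * δ * M := by rw [hB]; ring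
    _ = ε * M := by rw [hss, hδ]; field_simp

/-! ### Hölder regularity of `H¹` functions -/

/-- Cauchy–Schwarz for a vector integral `c`: pair `g` with the function equal to `c` on `S` and
zero elsewhere, then divide by `‖c‖`. -/
theorem norm_setIntegral_le {d : ℕ} {a b : ℝ} (g : L2 d a b) {S : Set ℝ} (hS : MeasurableSet S) :
    ‖∫ t in S, g t ∂(leb a b)‖ ≤ √((leb a b).real S) * ‖g‖ := by
  set c := ∫ t in S, g t ∂(leb a b) with hc
  have hμ : leb a b S ≠ ∞ := measure_ne_top _ _
  have h1 := L2.inner_indicatorConstLp_eq_inner_setIntegral ℝ hS hμ c g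
  rw [← hc, real_inner_self_eq_norm_sq] at h1
  have h2 := real_inner_le_norm (indicatorConstLp 2 hS hμ c) g
  rw [h1, norm_indicatorConstLp (by norm_num) (by norm_num)] at h2
  rcases eq_or_lt_of_le (norm_nonneg c) with h0 | h0
  · rw [← h0]; positivity
  · refine le_of_mul_le_mul_left ?_ h0
    rw [Real.sqrt_eq_rpow]
    calc ‖c‖ * ‖c‖ = ‖c‖ ^ 2 := by ring
      _ ≤ _ := h2
      _ = _ := by simp only [ENNReal.toReal_ofNat]; ring

theorem intervalIntegrable_L2 {d : ℕ} {h : ℝ} (g : L2 d 0 h) {t u : ℝ} (ht : t ∈ Icc 0 h)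
    (hu : u ∈ Icc 0 h) : IntervalIntegrable g volume t u := by
  have h1 : IntegrableOn g (Icc 0 h) volume := (Lp.memLp g).integrable (by norm_num)
  refine (intervalIntegrable_iff.2 (h1.mono_set ?_))
  exact uIoc_subset_uIcc.trans (uIcc_subset_Icc ht hu)

theorem norm_intervalIntegral_le {d : ℕ} {h : ℝ} (g : L2 d 0 h) {t u : ℝ} (ht : t ∈ Icc 0 h)
    (hu : u ∈ Icc 0 h) : ‖∫ r in t..u, g r‖ ≤ ‖g‖ * √|t - u| := by
  have hsub : uIoc t u ⊆ Icc 0 h := uIoc_subset_uIcc.trans (uIcc_subset_Icc ht hu)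
  have h1 := norm_setIntegral_le g (measurableSet_uIoc (a := t) (b := u))
  rw [Measure.restrict_restrict measurableSet_uIoc, inter_eq_left.2 hsub,
    measureReal_restrict_apply measurableSet_uIoc, inter_eq_left.2 hsub] at h1
  rw [intervalIntegral.norm_intervalIntegral_eq, mul_comm]
  have h2 : volume.real (uIoc t u) = |t - u| := by
    rw [uIoc, Real.volume_real_Ioc_of_le min_le_max, max_sub_min_eq_abs, abs_sub_comm]
  rwa [h2] at h1

theorem eq_zero_of_tsupport_subset_Ioo {ψ : ℝ → ℝ} {a b t : ℝ} (h : tsupport ψ ⊆ Ioo a b)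
    (ht : t ∉ Ioo a b) : ψ t = 0 := image_eq_zero_of_notMem_tsupport fun hm => ht (h hm)

/-- Integration by parts for the primitive of an `L²` function against a test function. -/
theorem integral_deriv_smul_primitive {d : ℕ} {h : ℝ} (g : L2 d 0 h) {ψ : ℝ → ℝ}
    (hψ : ContDiff ℝ (⊤ : ℕ∞) ψ) (hc : HasCompactSupport ψ) (hs : tsupport ψ ⊆ Ioo 0 h) :
    ∫ t in Icc 0 h, deriv ψ t • ∫ r in (0 : ℝ)..t, g r = - ∫ t in Icc 0 h, ψ t • g t := by
  have hd : Continuous (deriv ψ) := hψ.continuous_deriv (by simp)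
  obtain ⟨K, hK⟩ := hd.bounded_above_of_compact_support hc.deriv
  -- Fubini on the triangle `r ≤ t`: integrating `deriv ψ` from `r` to `h` leaves `-ψ r`, because `ψ
  -- h = 0`.
  have hint : Integrable (Function.uncurry fun t r : ℝ =>
      (if r ≤ t then deriv ψ t else 0) • g r) ((leb 0 h).prod (leb 0 h)) := by
    have h1 : Integrable (fun p : ℝ × ℝ => g p.2) ((leb 0 h).prod (leb 0 h)) :=
      ((Lp.memLp g).integrable (by norm_num)).comp_snd _
    refine h1.bdd_smul (φ := fun p : ℝ × ℝ => if p.2 ≤ p.1 then deriv ψ p.1 else 0) K ?_ (Filter.Eventually.of_forall fun p => ?_)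
    · exact (Measurable.ite (measurableSet_le measurable_snd measurable_fst)
        (hd.measurable.comp measurable_fst) measurable_const).aestronglyMeasurable
    · split_ifs
      · exact hK _
      · rw [norm_zero]; exact (norm_nonneg _).trans (hK 0)
  have hswap := integral_integral_swap hint
  have hleft : ∀ t ∈ Icc 0 h, deriv ψ t • ∫ r in (0 : ℝ)..t, g r =
      ∫ r in Icc 0 h, (if r ≤ t then deriv ψ t else 0) • g r := by
    intro t ht
    rw [intervalIntegral.integral_of_le ht.1, ← integral_Icc_eq_integral_Ioc, ← integral_smul,
      ← inter_eq_right.2 (Icc_subset_Icc_right ht.2 : Icc 0 t ⊆ Icc 0 h),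
      ← setIntegral_indicator measurableSet_Icc]
    refine setIntegral_congr_fun measurableSet_Icc fun r hr => ?_
    by_cases hrt : r ≤ t
    · simp [hrt, hr.1]
    · simp [hrt]
  have hright : ∀ r ∈ Icc 0 h, ∫ t in Icc 0 h, (if r ≤ t then deriv ψ t else 0) • g r =
      -(ψ r • g r) := by
    intro r hr
    rw [integral_smul_const, ← neg_smul]
    congr 1
    have h1 : ∫ t in r..h, deriv ψ t = ψ h - ψ r :=
      intervalIntegral.integral_deriv_eq_sub
        (fun t _ => (hψ.differentiable (by simp)).differentiableAt) (hd.intervalIntegrable _ _)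
    rw [eq_zero_of_tsupport_subset_Ioo hs (t := h) (by simp), zero_sub,
      intervalIntegral.integral_of_le hr.2, ← integral_Icc_eq_integral_Ioc] at h1
    rw [← h1, ← inter_eq_right.2 (Icc_subset_Icc_left hr.1 : Icc r h ⊆ Icc 0 h),
      ← setIntegral_indicator measurableSet_Icc]
    refine setIntegral_congr_fun measurableSet_Icc fun t ht => ?_
    by_cases hrt : r ≤ t
    · simp [hrt, ht.2]
    · simp [hrt]
  rw [setIntegral_congr_fun measurableSet_Icc hleft, hswap,
    setIntegral_congr_fun measurableSet_Icc hright, integral_neg]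

theorem exists_Icc_of_isCompact_subset_Ioo {K : Set ℝ} (hK : IsCompact K) {h : ℝ} (hh : 0 < h)
    (hs : K ⊆ Ioo 0 h) : ∃ a b, 0 < a ∧ b < h ∧ K ⊆ Icc a b := by
  rcases K.eq_empty_or_nonempty with rfl | hne
  · exact ⟨h / 2, h / 2, by linarith, by linarith, empty_subset _⟩
  · exact ⟨sInf K, sSup K, (hs (hK.sInf_mem hne)).1, (hs (hK.sSup_mem hne)).2,
      fun x hx => ⟨csInf_le hK.bddBelow hx, le_csSup hK.bddAbove hx⟩⟩

/-- A test function on `(0, h)` with zero mean is the derivative of a test function. -/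
theorem exists_test_primitive {h : ℝ} (hh : 0 < h) {η : ℝ → ℝ} (hη : ContDiff ℝ (⊤ : ℕ∞) η)
    (hc : HasCompactSupport η) (hs : tsupport η ⊆ Ioo 0 h) (h0 : ∫ t in (0 : ℝ)..h, η t = 0) :
    ∃ ψ : ℝ → ℝ, ContDiff ℝ (⊤ : ℕ∞) ψ ∧ HasCompactSupport ψ ∧ tsupport ψ ⊆ Ioo 0 h ∧
      deriv ψ = η := by
  obtain ⟨a, b, ha, hb, hab⟩ := exists_Icc_of_isCompact_subset_Ioo hc hh hs
  set ψ : ℝ → ℝ := fun t => ∫ r in (0 : ℝ)..t, η r with hψ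
  have hderiv : deriv ψ = η := by
    funext t
    exact hη.continuous.deriv_integral _ _ _
  have hdiff : Differentiable ℝ ψ := fun t =>
    (hη.continuous.integral_hasStrictDerivAt 0 t).hasDerivAt.differentiableAt
  have hη0 : ∀ t, t ∉ Icc a b → η t = 0 := fun t ht =>
    image_eq_zero_of_notMem_tsupport fun hm => ht (hab hm)
  -- To the left of `a` the integrand vanishes; to the right of `b` the primitive equals the total
  -- integral, which is zero.
  have hsupp : Function.support ψ ⊆ Icc a b := by
    intro t ht
    by_contra hnot
    apply ht
    rcases lt_or_ge t a with hta | hta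
    · refine (intervalIntegral.integral_congr (g := fun _ => 0) fun r hr => ?_).trans (by simp)
      refine hη0 r fun hm => ?_
      have h1 : r ≤ max 0 t := hr.2
      have h2 := hm.1
      have h3 : max 0 t < a := max_lt ha hta
      linarith
    · have htb : b < t := by
        by_contra hcon
        exact hnot ⟨hta, not_lt.1 hcon⟩
      have h1 : ∫ r in t..h, η r = 0 := by
        refine (intervalIntegral.integral_congr (g := fun _ => 0) fun r hr => ?_).trans (by simp)
        refine hη0 r fun hm => ?_
        have h1 : min t h ≤ r := hr.1
        have h2 := hm.2
        have h3 : b < min t h := lt_min htb hb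
        linarith
      have h2 := intervalIntegral.integral_add_adjacent_intervals
        (hη.continuous.intervalIntegrable (μ := volume) 0 t)
        (hη.continuous.intervalIntegrable (μ := volume) t h)
      rw [h1, h0, add_zero] at h2
      exact h2
  have hts : tsupport ψ ⊆ Icc a b := closure_minimal hsupp isClosed_Icc
  refine ⟨ψ, ?_, HasCompactSupport.of_support_subset_isCompact isCompact_Icc hsupp,
    hts.trans fun t ht => ⟨ha.trans_le ht.1, ht.2.trans_lt hb⟩, hderiv⟩
  rw [contDiff_infty_iff_deriv]
  exact ⟨hdiff, hderiv ▸ hη⟩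

/-- The lemma of du Bois-Reymond on `(0, h)`. -/
theorem ae_eq_const_of_integral_deriv_smul_eq_zero {d : ℕ} {h : ℝ} (hh : 0 < h) {u : ℝ → Vec d}
    (hu : Integrable u (leb 0 h))
    (h0 : ∀ ψ : ℝ → ℝ, ContDiff ℝ (⊤ : ℕ∞) ψ → HasCompactSupport ψ → tsupport ψ ⊆ Ioo 0 h →
      ∫ t in Icc 0 h, deriv ψ t • u t = 0) :
    ∃ c, u =ᵐ[leb 0 h] fun _ => c := by
  -- For a test function `χ` of integral `m`, `χ - m * ρ` has zero mean and is the derivative of a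
  -- test function. Hence `∫ χ u = m ∫ ρ u`, which identifies the constant as `∫ ρ u`.
  obtain ⟨ρ, hρ, hρc, hρs, hρ1⟩ : ∃ ρ : ℝ → ℝ, ContDiff ℝ (⊤ : ℕ∞) ρ ∧ HasCompactSupport ρ ∧
      tsupport ρ ⊆ Ioo 0 h ∧ ∫ t in (0 : ℝ)..h, ρ t = 1 := by
    let B : ContDiffBump (h / 2) := ⟨h / 8, h / 4, by positivity, by linarith⟩
    have hts : tsupport (B.normed volume) ⊆ Ioo 0 h := by
      rw [B.tsupport_normed_eq, Real.closedBall_eq_Icc]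
      intro t ht
      have h1 : h / 2 - h / 4 ≤ t := ht.1
      have h2 : t ≤ h / 2 + h / 4 := ht.2
      constructor <;> linarith
    refine ⟨B.normed volume, B.contDiff_normed, B.hasCompactSupport_normed, hts, ?_⟩
    rw [intervalIntegral.integral_of_le hh.le, setIntegral_eq_integral_of_forall_compl_eq_zero,
      B.integral_normed]
    intro t ht
    exact eq_zero_of_tsupport_subset_Ioo hts fun hm => ht (Ioo_subset_Ioc_self hm)
  have hint : ∀ χ : ℝ → ℝ, Continuous χ → HasCompactSupport χ →
      Integrable (fun t => χ t • u t) (leb 0 h) := by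
    intro χ hχ hχc
    obtain ⟨K, hK⟩ := hχ.bounded_above_of_compact_support hχc
    exact hu.bdd_smul K hχ.aestronglyMeasurable (Filter.Eventually.of_forall hK)
  set c := ∫ t in Icc 0 h, ρ t • u t with hc
  refine ⟨c, ?_⟩
  have hkey := (isOpen_Ioo (a := (0 : ℝ)) (b := h)).ae_eq_zero_of_integral_contDiff_smul_eq_zero
    (μ := leb 0 h) (f := fun t => u t - c)
    ((hu.sub (integrable_const c)).locallyIntegrable.locallyIntegrableOn _) ?_
  · have hIoo : ∀ᵐ t ∂(leb 0 h), t ∈ Ioo 0 h := by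
      rw [leb, ← restrict_Ioo_eq_restrict_Icc]
      exact ae_restrict_mem measurableSet_Ioo
    filter_upwards [hkey, hIoo] with t h1 h2
    exact sub_eq_zero.1 (h1 h2)
  · intro χ hχ hχc hχs
    set m := ∫ t in (0 : ℝ)..h, χ t with hm
    have hη : ContDiff ℝ (⊤ : ℕ∞) fun t => χ t - m * ρ t := hχ.sub (contDiff_const.mul hρ)
    have hmρ : HasCompactSupport fun t => m * ρ t := hρc.mul_left
    have hsub : tsupport (fun t => χ t - m * ρ t) ⊆ tsupport χ ∪ tsupport ρ := by
      refine closure_minimal (fun t ht => ?_) ((isClosed_tsupport _).union (isClosed_tsupport _))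
      by_contra hnot
      rw [mem_union, not_or] at hnot
      apply ht
      simp [image_eq_zero_of_notMem_tsupport hnot.1, image_eq_zero_of_notMem_tsupport hnot.2]
    obtain ⟨ψ, h1, h2, h3, h4⟩ := exists_test_primitive hh hη (hχc.sub hmρ)
      (hsub.trans (union_subset hχs hρs)) (by
        rw [intervalIntegral.integral_sub (hχ.continuous.intervalIntegrable _ _)
          ((hρ.continuous.intervalIntegrable _ _).const_mul m),
          intervalIntegral.integral_const_mul, hρ1, mul_one, sub_self])
    have h5 := h0 ψ h1 h2 h3
    rw [h4] at h5
    simp only [sub_smul, mul_smul] at h5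
    have hmi : Integrable (fun t => m • ρ t • u t) (leb 0 h) := (hint ρ hρ.continuous hρc).smul m
    rw [integral_sub (hint χ hχ.continuous hχc) hmi, integral_smul, ← hc] at h5
    simp only [smul_sub]
    have hχi : Integrable χ (leb 0 h) :=
      (hχ.continuous.integrable_of_hasCompactSupport hχc).restrict
    rw [integral_sub (hint χ hχ.continuous hχc) (hχi.smul_const c), integral_smul_const,
      integral_Icc_eq_integral_Ioc (f := χ), ← intervalIntegral.integral_of_le hh.le]
    exact h5

/-- An `H¹` class has a Hölder continuous representative. -/
theorem HasWeakDeriv.exists_representative {d : ℕ} {h : ℝ} (hh : 0 < h) {w g : L2 d 0 h}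
    (hw : HasWeakDeriv w g) : ∃ f : ℝ → Vec d, (w : ℝ → Vec d) =ᵐ[leb 0 h] f ∧
      ∀ t ∈ Icc 0 h, ∀ u ∈ Icc 0 h, ‖f t - f u‖ ≤ ‖g‖ * √|t - u| := by
  have h0 : (0 : ℝ) ∈ Icc 0 h := left_mem_Icc.2 hh.le
  set G : ℝ → Vec d := fun t => ∫ r in (0 : ℝ)..t, g r with hG
  have hGsub : ∀ t ∈ Icc 0 h, ∀ u ∈ Icc 0 h, ‖G t - G u‖ ≤ ‖g‖ * √|t - u| := by
    intro t ht u hu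
    rw [hG]
    simp only
    rw [intervalIntegral.integral_interval_sub_left (intervalIntegrable_L2 g h0 ht)
      (intervalIntegrable_L2 g h0 hu), abs_sub_comm]
    exact norm_intervalIntegral_le g hu ht
  have hGc : ContinuousOn G (Icc 0 h) := by
    have := intervalIntegral.continuousOn_primitive_interval (μ := volume) (f := g) (a := 0)
      (b := h) (by
        rw [uIcc_of_le hh.le]
        exact (Lp.memLp g).integrable (by norm_num))
    rwa [uIcc_of_le hh.le] at this
  have hGi : Integrable G (leb 0 h) := hGc.integrableOn_Icc
  have hwi : Integrable w (leb 0 h) := (Lp.memLp w).integrable (by norm_num)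
  -- `w` and the primitive `G` of `g` have the same weak derivative, so they differ by a constant.
  obtain ⟨c, hc⟩ := ae_eq_const_of_integral_deriv_smul_eq_zero hh (hwi.sub hGi)
    fun ψ h1 h2 h3 => by
      have hd : Continuous (deriv ψ) := h1.continuous_deriv (by simp)
      obtain ⟨K, hK⟩ := hd.bounded_above_of_compact_support h2.deriv
      have hdG : Integrable (fun t => deriv ψ t • G t) (leb 0 h) :=
        hGi.bdd_smul K hd.aestronglyMeasurable (Filter.Eventually.of_forall hK)
      simp only [Pi.sub_apply, smul_sub]
      rw [integral_sub (integrable_test hd h2.deriv w) hdG,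
        hw ψ h1 h2 h3, hG, integral_deriv_smul_primitive g h1 h2 h3, sub_self]
  refine ⟨fun t => c + G t, ?_, fun t ht u hu => ?_⟩
  · filter_upwards [hc] with t ht
    rw [← ht]; simp
  · rw [add_sub_add_left_eq_sub]
    exact hGsub t ht u hu

/-! ### Volterra estimates and invertibility of `I - 𝓕 V⁺` -/

section Volterra

variable {d : ℕ} {s τ h : ℝ} {C : ℝ → ℝ → Matrix (Fin d) (Fin d) ℝ}

theorem Vplus_ae_eq (w : L2 d 0 h) :
    (Vplus d τ h w : ℝ → Vec d) =ᵐ[leb (-τ) h] (Ioc 0 h).indicator w := by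
  have h1 : (Vplus d τ h w : ℝ → Vec d) =ᵐ[leb (-τ) h]
      glueFun h ((0 : L2 d (-τ) 0) : ℝ → Vec d) w :=
    (memLp_glueFun (0 : L2 d (-τ) 0) w).coeFn_toLp
  refine h1.trans ((glueFun_congr_ae (Lp.coeFn_zero _ _ _) (Filter.EventuallyEq.refl _ _)).trans
    (Filter.Eventually.of_forall fun t => ?_))
  by_cases ht : t ∈ Ioc 0 h
  · rw [indicator_of_mem ht]; exact if_pos ht
  · rw [indicator_of_notMem ht]; exact if_neg ht

theorem integrable_norm_L2 (w : L2 d 0 h) : IntegrableOn (fun u => ‖w u‖) (Icc 0 h) volume :=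
  ((Lp.memLp w).integrable (by norm_num)).norm

/-- `𝓕 V⁺` is dominated by a Volterra operator with constant kernel. -/
theorem exists_norm_FVplus_le (hC : HypH1 s τ h C) : ∃ M : ℝ, 0 ≤ M ∧ ∀ w : L2 d 0 h,
    ∀ᵐ t ∂(leb 0 h), ‖FVplus hC w t‖ ≤ M * ∫ u in (0 : ℝ)..t, ‖w u‖ := by
  obtain ⟨K, hK0, hK⟩ := hC.exists_bound
  refine ⟨d * (d * K), by positivity, fun w => ?_⟩
  set v := Vplus d τ h w with hv
  have hF : (FVplus hC w : ℝ → Vec d) =ᵐ[leb 0 h] delayIntegral s τ C v :=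
    (hC.memLp_delayIntegral v).coeFn_toLp
  filter_upwards [hF, hK, ae_restrict_mem measurableSet_Icc] with t hFt hKt ht
  rw [hFt]
  calc ‖delayIntegral s τ C v t‖
      ≤ ∫ θ, (d * (d * K)) * ‖v (t + θ)‖ ∂(leb (-τ) 0) := by
        refine norm_integral_le_of_norm_le ((integrable_translate v ht).norm.const_mul _) ?_
        filter_upwards [hKt] with θ hθ
        exact norm_toEuclideanLin_le _ _ hθ
    _ = (d * (d * K)) * ∫ θ, ‖v (t + θ)‖ ∂(leb (-τ) 0) := integral_const_mul _ _
    _ ≤ _ := by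
        refine mul_le_mul_of_nonneg_left ?_ (by positivity)
        -- The substitution `u = t + θ` turns the delay window into `[t - τ, t]`, where `V⁺ w` can
        -- be nonzero only on `(0, t]`.
        rw [(translate_measurePreserving τ t).integral_comp (measurableEmbedding_addLeft t)
          (fun u => ‖v u‖)]
        have hae : (fun u => ‖v u‖) =ᵐ[leb (t - τ) t] (Ioc 0 h).indicator fun u => ‖w u‖ := by
          filter_upwards [ae_mono (leb_translate_le (τ := τ) ht) (Vplus_ae_eq (τ := τ) w)] with u hu
          rw [hv, hu, norm_indicator_eq_indicator_norm]
        rw [integral_congr_ae hae, setIntegral_indicator measurableSet_Ioc,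
          intervalIntegral.integral_of_le ht.1]
        refine setIntegral_mono_set ((integrable_norm_L2 w).mono_set
          (Ioc_subset_Icc_self.trans (Icc_subset_Icc_right ht.2)))
          (Filter.Eventually.of_forall fun _ => norm_nonneg _) (LE.le.eventuallyLE ?_)
        exact fun u hu => ⟨hu.2.1, hu.1.2⟩

/-- The first application bounds the function by a constant multiple of the `L¹` norm of `w`; each
further one integrates the power of `t` once more. -/
theorem norm_pow_FVplus_le (hC : HypH1 s τ h C) {M : ℝ} (hM : 0 ≤ M)
    (hA : ∀ w : L2 d 0 h, ∀ᵐ t ∂(leb 0 h), ‖FVplus hC w t‖ ≤ M * ∫ u in (0 : ℝ)..t, ‖w u‖)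
    (w : L2 d 0 h) (n : ℕ) : ∀ᵐ t ∂(leb 0 h), ‖((FVplus hC ^ (n + 1)) w : L2 d 0 h) t‖ ≤
      M ^ (n + 1) * (∫ u in Icc 0 h, ‖w u‖) * (t ^ n / n.factorial) := by
  set c := ∫ u in Icc 0 h, ‖w u‖ with hc
  induction n with
  | zero =>
    filter_upwards [hA w, ae_restrict_mem measurableSet_Icc] with t hAt ht
    rw [zero_add, pow_one]
    refine hAt.trans ?_
    rw [pow_one, pow_zero, Nat.factorial_zero, Nat.cast_one, div_one, mul_one]
    refine mul_le_mul_of_nonneg_left ?_ hM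
    rw [intervalIntegral.integral_of_le ht.1]
    exact setIntegral_mono_set (integrable_norm_L2 w)
      (Filter.Eventually.of_forall fun _ => norm_nonneg _)
      (LE.le.eventuallyLE (Ioc_subset_Icc_self.trans (Icc_subset_Icc_right ht.2)))
  | succ n ih =>
    filter_upwards [hA ((FVplus hC ^ (n + 1)) w), ae_restrict_mem measurableSet_Icc] with t hAt ht
    rw [pow_succ' (FVplus hC), Module.End.mul_apply]
    refine hAt.trans ?_
    have hcont : Continuous fun u : ℝ => M ^ (n + 1) * c * (u ^ n / n.factorial) := by fun_prop
    have hle : ∫ u in (0 : ℝ)..t, ‖((FVplus hC ^ (n + 1)) w : L2 d 0 h) u‖ ≤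
        ∫ u in (0 : ℝ)..t, M ^ (n + 1) * c * (u ^ n / n.factorial) := by
      refine intervalIntegral.integral_mono_ae_restrict ht.1 ?_ (hcont.intervalIntegrable _ _) ?_
      · exact (intervalIntegrable_L2 _ (left_mem_Icc.2 (ht.1.trans ht.2)) ht).norm
      · exact ae_mono (Measure.restrict_mono (Icc_subset_Icc_right ht.2) le_rfl) ih
    have hval : ∫ u in (0 : ℝ)..t, M ^ (n + 1) * c * (u ^ n / n.factorial) =
        M ^ (n + 1) * c * (t ^ (n + 1) / (n + 1).factorial) := by
      rw [intervalIntegral.integral_const_mul, intervalIntegral.integral_div, integral_pow,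
        zero_pow n.succ_ne_zero, sub_zero, div_div, Nat.factorial_succ]
      push_cast
      rfl
    rw [hval] at hle
    calc M * ∫ u in (0 : ℝ)..t, ‖((FVplus hC ^ (n + 1)) w : L2 d 0 h) u‖
        ≤ M * (M ^ (n + 1) * c * (t ^ (n + 1) / (n + 1).factorial)) :=
          mul_le_mul_of_nonneg_left hle hM
      _ = _ := by ring

theorem integral_norm_L2_le (hh : 0 < h) (w : L2 d 0 h) : ∫ u in Icc 0 h, ‖w u‖ ≤ √h * ‖w‖ := by
  set m := ∫ u in Icc 0 h, ‖w u‖ with hm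
  refine le_of_sq_le_sq ?_ (by positivity)
  rw [mul_pow, Real.sq_sqrt hh.le, norm_sq_L2]
  have h1 : IntegrableOn (fun u => ‖w u‖) (Icc 0 h) volume := integrable_norm_L2 w
  have h2 : IntegrableOn (fun u => ‖w u‖ ^ 2) (Icc 0 h) volume := (Lp.memLp w).norm.integrable_sq
  -- Cauchy–Schwarz in variance form, with `m / h` the mean of `‖w‖`.
  have h3 : 0 ≤ ∫ u in Icc 0 h, (‖w u‖ ^ 2 - 2 * (m / h) * ‖w u‖ + (m / h) ^ 2) :=
    integral_nonneg fun u => by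
      simp only [Pi.zero_apply]
      nlinarith [sq_nonneg (‖w u‖ - m / h)]
  have h4 : IntegrableOn (fun u => 2 * (m / h) * ‖w u‖) (Icc 0 h) volume := h1.const_mul _
  have h24 : IntegrableOn (fun u => ‖w u‖ ^ 2 - 2 * (m / h) * ‖w u‖) (Icc 0 h) volume := h2.sub h4
  rw [integral_add h24 (integrable_const _), integral_sub h2 h4, integral_const_mul,
    ← hm, integral_const] at h3
  simp only [measureReal_restrict_apply_univ, Real.volume_real_Icc, sub_zero, smul_eq_mul,
    max_eq_left hh.le] at h3
  have h5 : h * (m / h) ^ 2 = m ^ 2 / h := by field_simp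
  have h6 : 2 * (m / h) * m = 2 * (m ^ 2 / h) := by ring
  rw [h5, h6] at h3
  have h7 : m ^ 2 / h ≤ ∫ u in Icc 0 h, ‖w u‖ ^ 2 := by linarith
  rwa [div_le_iff₀ hh, mul_comm] at h7

/-- One `√h` comes from bounding the `L¹` norm by the `L²` norm, the other from passing from a
uniform bound back to `L²`. -/
theorem norm_pow_FVplus_apply_le (hC : HypH1 s τ h C) (hh : 0 < h) {M : ℝ} (hM : 0 ≤ M)
    (hA : ∀ w : L2 d 0 h, ∀ᵐ t ∂(leb 0 h), ‖FVplus hC w t‖ ≤ M * ∫ u in (0 : ℝ)..t, ‖w u‖)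
    (n : ℕ) (w : L2 d 0 h) :
    ‖(FVplus hC ^ (n + 1)) w‖ ≤ M * h * ((M * h) ^ n / n.factorial) * ‖w‖ := by
  have hc : 0 ≤ ∫ u in Icc 0 h, ‖w u‖ := integral_nonneg fun _ => norm_nonneg _
  have h1 := norm_L2_le_of_bound hh ((FVplus hC ^ (n + 1)) w)
    (B := M ^ (n + 1) * (√h * ‖w‖) * (h ^ n / n.factorial)) (by positivity) (by
      filter_upwards [norm_pow_FVplus_le hC hM hA w n, ae_restrict_mem measurableSet_Icc]
        with t ht hI
      refine ht.trans ?_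
      have h2 := hI.1
      gcongr
      · exact integral_norm_L2_le hh w
      · exact hI.2)
  refine h1.trans (le_of_eq ?_)
  have hss : √h * √h = h := Real.mul_self_sqrt hh.le
  calc _ = (√h * √h) * (M ^ (n + 1) * ‖w‖ * (h ^ n / n.factorial)) := by ring
    _ = _ := by rw [hss]; ring

/-- `I - 𝓕 V⁺` is invertible with bounded inverse. -/
theorem exists_isBoundedInverse_exactOp (hC : HypH1 s τ h C) (hh : 0 < h) :
    ∃ S : L2 d 0 h →L[ℝ] L2 d 0 h, IsBoundedInverse (exactOp hC) S := by
  obtain ⟨M, hM, hA⟩ := exists_norm_FVplus_le hC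
  have hpow := norm_pow_FVplus_apply_le hC hh hM hA
  let T : L2 d 0 h →L[ℝ] L2 d 0 h := (FVplus hC).mkContinuous (M * h) fun w => by
    simpa using hpow 0 w
  have hTpow : ∀ n w, (T ^ n) w = (FVplus hC ^ n) w := by
    intro n
    induction n with
    | zero => intro w; rfl
    | succ n ih =>
      intro w
      rw [pow_succ', pow_succ', mul_apply_eq_comp, ih]
      rfl
  obtain ⟨n, hn⟩ : ∃ n : ℕ, ‖T ^ (n + 1)‖ < 1 := by
    have hlim : Filter.Tendsto (fun n : ℕ => M * h * ((M * h) ^ n / n.factorial)) Filter.atTop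
        (nhds 0) := by
      simpa using (FloorSemiring.tendsto_pow_div_factorial_atTop (M * h)).const_mul (M * h)
    obtain ⟨n, hn⟩ := (hlim.eventually (gt_mem_nhds one_pos)).exists
    refine ⟨n, lt_of_le_of_lt (ContinuousLinearMap.opNorm_le_bound _ (by positivity) fun w => ?_) hn⟩
    rw [hTpow]
    exact hpow n w
  have hunit : IsUnit (1 - T) := by
    -- `1 - T ^ (n + 1)` is the product of `1 - T` and a geometric sum; as the factors commute, each
    -- of them is a unit.
    have h1 : IsUnit (1 - T ^ (n + 1)) := isUnit_one_sub_of_norm_lt_one hn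
    have hcomm : Commute (1 - T) (∑ i ∈ Finset.range (n + 1), T ^ i) :=
      Commute.sum_right _ _ _ fun i _ =>
        ((Commute.one_left _).sub_left ((Commute.refl T).pow_right i))
    rw [← mul_neg_geom_sum] at h1
    exact (hcomm.isUnit_mul_iff.1 h1).1
  obtain ⟨U, hU⟩ := hunit
  refine ⟨(↑U⁻¹ : L2 d 0 h →L[ℝ] L2 d 0 h), fun w => ?_, fun w => ?_⟩
  · have := congrArg (fun L : L2 d 0 h →L[ℝ] L2 d 0 h => L w) U.inv_mul
    rw [hU] at this
    exact this
  · have := congrArg (fun L : L2 d 0 h →L[ℝ] L2 d 0 h => L w) U.mul_inv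
    rw [hU] at this
    exact this

end Volterra

/-! ### Operator norm convergence, perturbation and error bound -/

section Convergence

variable {d : ℕ} {s τ h : ℝ} {C : ℝ → ℝ → Matrix (Fin d) (Fin d) ℝ}

/-- Convergence in operator norm of `𝓛_N⁺ 𝓕 V⁺` to `𝓕 V⁺`. -/
theorem exists_norm_interp_FVplus_sub_le {hC : HypH1 s τ h C} (hF : HypH2 hC) (hh : 0 < h)
    (Y : EvaluationSpace d h) {ε : ℝ} (hε : 0 < ε) :
    ∃ N₀ : ℕ, 0 < N₀ ∧ ∀ N, N₀ ≤ N → ∀ w,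
      ‖interp Y N ⟨FVplus hC w, Y.sobolev_le (hF.1 w)⟩ - FVplus hC w‖ ≤ ε * ‖w‖ := by
  obtain ⟨hmem, K, hK⟩ := hF
  -- The Hölder constants are at most `|K| * ‖w‖`; adding 1 keeps the divisor positive.
  obtain ⟨N₀, hN₀, hN⟩ := exists_norm_interpFun_sub_le hh d (ε := ε / (|K| + 1)) (by positivity)
  refine ⟨N₀, hN₀, fun N hNN w => ?_⟩
  obtain ⟨g, hg⟩ := hmem w
  obtain ⟨f, hwf, hf⟩ := hg.exists_representative hh
  have hgK : ‖g‖ ≤ |K| * ‖w‖ := by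
    calc ‖g‖ = √(‖g‖ ^ 2) := (Real.sqrt_sq (norm_nonneg _)).symm
      _ ≤ √(‖FVplus hC w‖ ^ 2 + ‖g‖ ^ 2) :=
        Real.sqrt_le_sqrt (le_add_of_nonneg_left (by positivity))
      _ ≤ K * ‖w‖ := hK w g hg
      _ ≤ |K| * ‖w‖ := by gcongr; exact le_abs_self K
  have hfc : ContinuousOn f (Icc 0 h) := by
    intro t ht
    rw [ContinuousWithinAt, tendsto_iff_norm_sub_tendsto_zero]
    have hlim : Filter.Tendsto (fun u => ‖g‖ * √|u - t|) (nhdsWithin t (Icc 0 h)) (nhds 0) := by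
      have hc : Continuous fun u => ‖g‖ * √|u - t| := by fun_prop
      have := hc.tendsto t
      simp only [sub_self, abs_zero, Real.sqrt_zero, mul_zero] at this
      exact this.mono_left nhdsWithin_le_nhds
    refine squeeze_zero' (Filter.Eventually.of_forall fun _ => norm_nonneg _) ?_ hlim
    filter_upwards [self_mem_nhdsWithin] with u hu using hf u hu t ht
  set wY : Y.carrier := ⟨FVplus hC w, Y.sobolev_le (hmem w)⟩ with hwY
  -- The nodes lie in `[0, h]`, where evaluation in `Y` must agree with the continuous
  -- representative, so the interpolant is that of `f`.
  have heval := Y.eval_of_continuousOn wY f hfc hwf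
  have heq : interpFun h N (Y.eval wY) = interpFun h N f := by
    funext t
    exact Finset.sum_congr rfl fun θ hθ => by rw [heval (nodes_mem_Icc hh hθ)]
  have hint : interp Y N wY = (memLp_interpFun (h := h) N f).toLp (interpFun h N f) :=
    MemLp.toLp_congr (memLp_interpFun N (Y.eval wY)) _ (Filter.Eventually.of_forall fun t => congrFun heq t)
  rw [hint]
  refine (hN N hNN _ f ‖g‖ (norm_nonneg _) hwf hf).trans ?_
  have hK1 : |K| ≤ |K| + 1 := by linarith
  calc ε / (|K| + 1) * ‖g‖ ≤ ε / (|K| + 1) * ((|K| + 1) * ‖w‖) := by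
        gcongr
        exact hgK.trans (by gcongr)
    _ = ε * ‖w‖ := by field_simp

/-- Perturbation of a boundedly invertible operator. -/
theorem exists_isBoundedInverse_of_norm_sub_le {A B : L2 d 0 h →ₗ[ℝ] L2 d 0 h}
    {S : L2 d 0 h →L[ℝ] L2 d 0 h} (hS : IsBoundedInverse A S) {ε : ℝ} (hε0 : 0 ≤ ε)
    (hε : ‖S‖ * ε ≤ 1 / 2) (hAB : ∀ w, ‖A w - B w‖ ≤ ε * ‖w‖) :
    ∃ SN : L2 d 0 h →L[ℝ] L2 d 0 h, IsBoundedInverse B SN ∧ ‖SN‖ ≤ 2 * ‖S‖ := by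
  -- `B = A - E = A (1 - S E)`, so the inverse is `(1 - S E)⁻¹ S`.
  let E : L2 d 0 h →L[ℝ] L2 d 0 h := (A - B).mkContinuous ε hAB
  have hE : ∀ w, E w = A w - B w := fun _ => rfl
  have hSE : ‖S * E‖ ≤ 1 / 2 := by
    refine (norm_mul_le _ _).trans (le_trans ?_ hε)
    exact mul_le_mul_of_nonneg_left ((A - B).mkContinuous_norm_le hε0 hAB) (norm_nonneg _)
  obtain ⟨U, hU⟩ : IsUnit (1 - S * E) :=
    isUnit_one_sub_of_norm_lt_one (hSE.trans_lt (by norm_num))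
  have hU1 : ∀ w, (↑U⁻¹ : L2 d 0 h →L[ℝ] L2 d 0 h) (w - S (E w)) = w := by
    intro w
    have := congrArg (fun L : L2 d 0 h →L[ℝ] L2 d 0 h => L w) U.inv_mul
    rw [hU] at this
    exact this
  have hU2 : ∀ w, (↑U⁻¹ : L2 d 0 h →L[ℝ] L2 d 0 h) w -
      S (E ((↑U⁻¹ : L2 d 0 h →L[ℝ] L2 d 0 h) w)) = w := by
    intro w
    have := congrArg (fun L : L2 d 0 h →L[ℝ] L2 d 0 h => L w) U.mul_inv
    rw [hU] at this
    exact this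
  refine ⟨(↑U⁻¹ : L2 d 0 h →L[ℝ] L2 d 0 h) * S, ⟨fun w => ?_, fun w => ?_⟩, ?_⟩
  · rw [mul_apply_eq_comp]
    have : S (B w) = w - S (E w) := by rw [hE, map_sub, hS.1]; abel
    rw [this, hU1]
  · rw [mul_apply_eq_comp]
    have h1 := hU2 (S w)
    set z := (↑U⁻¹ : L2 d 0 h →L[ℝ] L2 d 0 h) (S w) with hz
    have h2 := congrArg A h1
    rw [map_sub, hS.2, hS.2, hE, sub_sub_cancel] at h2
    exact h2
  · refine ContinuousLinearMap.opNorm_le_bound _ (by positivity) fun w => ?_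
    rw [mul_apply_eq_comp]
    have h1 := hU2 (S w)
    set z := (↑U⁻¹ : L2 d 0 h →L[ℝ] L2 d 0 h) (S w) with hz
    -- From `z = S w + S E z` and `‖S E‖ ≤ 1 / 2`, half of `‖z‖` is absorbed on the left; hence the
    -- factor 2.
    have h2 : ‖z‖ ≤ ‖S w‖ + ‖(S * E) z‖ := by
      have : z = S w + (S * E) z := by rw [← h1, mul_apply_eq_comp]; abel
      calc ‖z‖ = ‖S w + (S * E) z‖ := by rw [← this]
        _ ≤ _ := norm_add_le _ _
    have h3 : ‖(S * E) z‖ ≤ 1 / 2 * ‖z‖ :=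
      ((S * E).le_opNorm z).trans (mul_le_mul_of_nonneg_right hSE (norm_nonneg _))
    have h4 := S.le_opNorm w
    linarith

theorem F_V_eq (hC : HypH1 s τ h C) (φ : L2 d (-τ) 0) (w : L2 d 0 h) :
    F hC (V d τ h (φ, w)) = FVminus hC φ + FVplus hC w := by
  have : (φ, w) = (φ, (0 : L2 d 0 h)) + ((0 : L2 d (-τ) 0), w) := by simp
  rw [this, map_add, map_add]
  rfl

theorem isFixedPoint_iff (hC : HypH1 s τ h C) (φ : L2 d (-τ) 0) (w : L2 d 0 h) :
    IsFixedPoint hC φ w ↔ exactOp hC w = FVminus hC φ := by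
  rw [IsFixedPoint, F_V_eq, exactOp, LinearMap.sub_apply, LinearMap.id_apply, sub_eq_iff_eq_add]

theorem isCollocationSolution_iff {hC : HypH1 s τ h C} (hF : HypH2 hC) (Y : EvaluationSpace d h)
    (N : ℕ) {φ : L2 d (-τ) 0} (hφ : FVminus hC φ ∈ Y.carrier) (w : L2 d 0 h) :
    IsCollocationSolution hC Y N φ w ↔
      collocationOp hF Y N w = interp Y N ⟨FVminus hC φ, hφ⟩ := by
  -- The right-hand side is meaningful for every `w`, because the `V⁺` part always lands in `H¹`.
  have hm : F hC (V d τ h (φ, w)) ∈ Y.carrier := by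
    rw [F_V_eq]; exact Y.carrier.add_mem hφ (Y.sobolev_le (hF.1 w))
  have hadd : interp Y N ⟨F hC (V d τ h (φ, w)), hm⟩ = interp Y N ⟨FVminus hC φ, hφ⟩ +
      interp Y N ⟨FVplus hC w, Y.sobolev_le (hF.1 w)⟩ := by
    rw [← map_add]
    congr 1
    exact Subtype.ext (F_V_eq hC φ w)
  have hcol : collocationOp hF Y N w =
      w - interp Y N ⟨FVplus hC w, Y.sobolev_le (hF.1 w)⟩ := rfl
  rw [hcol, sub_eq_iff_eq_add, ← hadd]
  exact ⟨fun ⟨_, h⟩ => h, fun h => ⟨hm, h⟩⟩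

theorem IsBoundedInverse.unique_solution {A : L2 d 0 h →ₗ[ℝ] L2 d 0 h}
    {S : L2 d 0 h →L[ℝ] L2 d 0 h} (hS : IsBoundedInverse A S) (y : L2 d 0 h) :
    A (S y) = y ∧ ∀ w, A w = y → w = S y :=
  ⟨hS.2 y, fun w hw => by rw [← hw, hS.1]⟩

end Convergence

end RenewalCollocation

theorem mainTheorem4 (d : ℕ) (s τ h : ℝ) (hτ : 0 < τ) (hh : 0 < h)
    (C : ℝ → ℝ → Matrix (Fin d) (Fin d) ℝ) (hC : HypH1 s τ h C) (hF : HypH2 hC)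
    (Y : EvaluationSpace d h) :
    ∃ S : L2 d 0 h →L[ℝ] L2 d 0 h, IsBoundedInverse (exactOp hC) S ∧
    ∃ N₀ : ℕ, 0 < N₀ ∧ ∀ N : ℕ, N₀ ≤ N →
      (∃ SN : L2 d 0 h →L[ℝ] L2 d 0 h,
        IsBoundedInverse (collocationOp hF Y N) SN ∧ ‖SN‖ ≤ 2 * ‖S‖) ∧
      ∀ φ : L2 d (-τ) 0, ∃ w : L2 d 0 h,
        (IsFixedPoint hC φ w ∧ ∀ w', IsFixedPoint hC φ w' → w' = w) ∧
        (FVminus hC φ ∈ Y.carrier →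
          ∃ wN : L2 d 0 h,
            (IsCollocationSolution hC Y N φ wN ∧
              ∀ w', IsCollocationSolution hC Y N φ w' → w' = wN) ∧
            ∃ hw : w ∈ Y.carrier,
              ‖wN - w‖ ≤ 2 * ‖S‖ * ‖interp Y N ⟨w, hw⟩ - w‖) := by
  obtain ⟨S, hS⟩ := exists_isBoundedInverse_exactOp hC hh
  -- This makes `‖S‖ * ε ≤ 1 / 2`; the added 1 covers `‖S‖ = 0`.
  have hε : 0 < 1 / (2 * (‖S‖ + 1)) := by positivity
  obtain ⟨N₀, hN₀, hN⟩ := exists_norm_interp_FVplus_sub_le hF hh Y hε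
  refine ⟨S, hS, N₀, hN₀, fun N hNN => ?_⟩
  obtain ⟨SN, hSN, hSN2⟩ := exists_isBoundedInverse_of_norm_sub_le (B := collocationOp hF Y N)
    hS hε.le (by
      rw [mul_one_div, div_le_div_iff₀ (by positivity) (by norm_num)]
      linarith) fun w => by
        refine le_of_eq_of_le ?_ (hN N hNN w)
        congr 1
        exact sub_sub_sub_cancel_left _ _ w
  refine ⟨⟨SN, hSN, hSN2⟩, fun φ => ?_⟩
  obtain ⟨hw1, hw2⟩ := hS.unique_solution (FVminus hC φ)
  set w := S (FVminus hC φ) with hw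
  refine ⟨w, ⟨(isFixedPoint_iff hC φ w).2 hw1,
    fun w' h' => hw2 w' ((isFixedPoint_iff hC φ w').1 h')⟩, fun hφ => ?_⟩
  obtain ⟨hN1, hN2⟩ := hSN.unique_solution (interp Y N ⟨FVminus hC φ, hφ⟩)
  set wN := SN (interp Y N ⟨FVminus hC φ, hφ⟩) with hwN
  refine ⟨wN, ⟨(isCollocationSolution_iff hF Y N hφ wN).2 hN1,
    fun w' h' => hN2 w' ((isCollocationSolution_iff hF Y N hφ w').1 h')⟩, ?_⟩
  have hwsum : w = FVminus hC φ + FVplus hC w := by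
    rw [← F_V_eq]; exact (isFixedPoint_iff hC φ w).2 hw1
  have hwY : w ∈ Y.carrier := by
    rw [hwsum]; exact Y.carrier.add_mem hφ (Y.sobolev_le (hF.1 w))
  refine ⟨hwY, ?_⟩
  -- The error equation: `𝓛_N⁺` is applied to `w = 𝓕 V⁻ φ + 𝓕 V⁺ w` and the collocation equation is
  -- subtracted.
  have hres : collocationOp hF Y N (wN - w) = interp Y N ⟨w, hwY⟩ - w := by
    have hadd : interp Y N ⟨w, hwY⟩ = interp Y N ⟨FVminus hC φ, hφ⟩ +
        interp Y N ⟨FVplus hC w, Y.sobolev_le (hF.1 w)⟩ := by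
      rw [← map_add]
      congr 1
      exact Subtype.ext hwsum
    have hcol : collocationOp hF Y N w =
        w - interp Y N ⟨FVplus hC w, Y.sobolev_le (hF.1 w)⟩ := rfl
    rw [map_sub, hN1, hcol, hadd]
    abel
  calc ‖wN - w‖ = ‖SN (interp Y N ⟨w, hwY⟩ - w)‖ := by rw [← hres, hSN.1]
    _ ≤ ‖SN‖ * ‖interp Y N ⟨w, hwY⟩ - w‖ := SN.le_opNorm _
    _ ≤ _ := mul_le_mul_of_nonneg_right hSN2 (norm_nonneg _)
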